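/- **Theorem (Probabilistic exhaustivity).** *Setting.* Let $\mathcal M\subseteq\mathbb R^N$ be open, let $g_1,\dots,g_m$ be smooth vector fields on $\mathcal M$, and let $U\subset\mathbb R^m$ be closed, bounded, symmetric about the origin, with $0$ in the interior of its convex hull. A *trajectory* is a continuous $x:[0,T]\to\mathcal M$, $T\ge 0$, with $x(t)=x(0)+\int_0^t\sum_i u_i(s)g_i(x(s))\,ds$ for some measurable $U$-valued control $u$; its cost is its Euclidean arc length $c(x)=\int_0^T\|\dot x(t)\|\,dt$, and $d(p,q)\in[0,\infty]$ is the infimum of the costs of the trajectories from $p$ to $q$. Let $L^k(p)$ be the span of the values at $p$ of the iterated Lie brackets of $g_1,\dots,g_m$ with at most $k$ terms, $n_k(p)=\dim L^k(p)$, $s(p)=\min\{k: L^k(p)=\mathbb R^N\}$, $w_i(p)=\min\{k: n_k(p)\ge i\}$ for $1\le i\le N$, and $D(p)=\sum_i w_i(p)$. *Privileged coordinates* at $p$ are functions $z_i=y_i+\mathrm{poly}_i(y_1,\dots,y_{i-1})$, where $y$ are the linear coordinates centred at $p$ with respect to an orthonormal basis $Y_1,\dots,Y_N$ of $\mathbb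 R^N$ such that $\{Y_i: w_i(p)\le k\}$ spans $L^k(p)$ for every $k$, $\mathrm{poly}_i$ has only terms of degree at least $2$ and less than $w_i(p)$, and $z_i$ has nonholonomic order $w_i(p)$ at $p$ (all derivatives $g_{j_1}\cdots g_{j_l}z_i(p)$ with $l<w_i(p)$ vanish, and some one with $l=w_i(p)$ does not). Put $\|z\|_p=\max_i|z_i|^{1/w_i(p)}$. *Assumptions $A_\Sigma$*, with constants $0<a_{\min}\le A_{\max}$, $\sigma_{\min}>0$, $\theta_{\min}>0$: (a) for every $p\in\mathcal M$ some $L^k(p)$ is $\mathbb R^N$; (b) the numbers $n_k$, $k\ge1$, are constant near every point of $\mathcal M$; (c) at every $p\in\mathcal M$ there are privileged coordinates $z$ with $a_{\min}\|z(q)\|_p\le d(p,q)\le A_{\max}\|z(q)\|_p$ for all $q\in\mathcal M$ with $d(p,q)<\sigma_{\min}$; (d) $\|p-q\|\le d(p,q)\le 2A_{\max}\|p-q\|^{1/s(p)}$ for all $p,q\in\mathcal M$ with $\|p-q\|\le\theta_{\min}$. Let $\mathcal M_{\rm obs}\subseteq\mathcal M$ with $\mathcal M\setminus\mathcal M_{\rm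 obs}$ open, let $\mathcal M_{\rm free}$ be the closure of $\mathcal M\setminus\mathcal M_{\rm obs}$ in $\mathcal M$, with Lebesgue measure $\mu(\mathcal M_{\rm free})<\infty$, and let $x_{\rm init}\in\mathcal M_{\rm free}$. Let $x:[0,T]\to\mathcal M_{\rm free}$ be a trajectory with strong $\delta$-clearance, $\delta>0$: $\|x(t)-q\|\ge\delta$ for all $t\in[0,T]$ and $q\in\mathcal M_{\rm obs}$. Let $D=D(x(0))$. *Tracing.* Points $y_1,\dots,y_M$, $M\ge1$, *$(\varepsilon,r)$-trace* $x$ if (i) $d(y_j,y_{j+1})\le r$ for all $j<M$; (ii) there is $\kappa>0$ such that every trajectory $y^*$ that runs through $y_1,\dots,y_M$ in this order, from $y_1$ to $y_M$, with each piece from $y_j$ to $y_{j+1}$ of length at most $d(y_j,y_{j+1})+\kappa$ (in particular every concatenation of optimal connections) satisfies $c(y^*)\le(1+\varepsilon)c(x)$ and lies within $r$ of $x$, that is, every point of $y^*$ has $d$-distance at most $r$ from some $x(t)$; moreover such $y^*$ exist for every $\kappa>0$; (iii) $[0,T]$ is a union of consecutive intervals $I_1,\dots,I_M$ with $d(y_j,x(t))\le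 r$ for all $t\in I_j$. *Claim.* Let $\varepsilon>0$, $\eta\ge0$, and $$r_n=4A_{\max}(1+\eta)^{1/D}\left(\frac{\mu(\mathcal M_{\rm free})}{D}\right)^{1/D}\left(\frac{\log n}{n}\right)^{1/D}.$$ Let $V$ consist of $x_{\rm init}$ and $n$ independent uniform samples from $\mathcal M_{\rm free}$, and let $A_n$ be the event that some $y_1,\dots,y_M\in V$ $(\varepsilon,r_n)$-trace $x$, with $y_1=x_{\rm init}$ in case $x(0)=x_{\rm init}$. Then, as $n\to\infty$, $$\mathbb P(A_n^c)=O\!\left(n^{-\eta/D}(\log n)^{-1/D}\right).$$ -/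

import Mathlib

open MeasureTheory Set Filter Topology
open scoped ENNReal NNReal

noncomputable section

namespace DCA

/-- The ambient Euclidean space `ℝ^N`. -/
abbrev E (N : ℕ) : Type := EuclideanSpace ℝ (Fin N)

/-- A driftless control-affine system `ẋ = ∑ i, u i • g i x`, `x ∈ M`, `u ∈ U`, on a configuration
manifold `M ⊆ ℝ^N` of full dimension `N` (that is, `M` is open). -/
structure System (N m : ℕ) where
  /-- configuration manifold -/
  M : Set (E N)
  isOpen_M : IsOpen M
  /-- control vector fields -/
  g : Fin m → E N → E N
  smooth_g : ∀ i, ContDiffOn ℝ ((⊤ : ℕ∞) : WithTop ℕ∞) (g i) M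
  /-- control set -/
  U : Set (E m)
  isClosed_U : IsClosed U
  isBounded_U : Bornology.IsBounded U
  symm_U : ∀ u ∈ U, -u ∈ U
  zero_mem_U : (0 : E m) ∈ interior (convexHull ℝ U)

namespace System

variable {N m : ℕ} (S : System N m)

/-! ### Trajectories, arc length, sub-Riemannian distance -/

/-- `x : [0,T] → M` is dynamically feasible: it is continuous and solves the system for some
measurable `U`-valued control, in the Carathéodory (integral) sense. Only the values of `x` on
`[0,T]` matter. -/
def IsTrajectory (x : ℝ → E N) (T : ℝ) : Prop :=
  0 ≤ T ∧ ContinuousOn x (Icc 0 T) ∧ (∀ t ∈ Icc 0 T, x t ∈ S.M) ∧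
    ∃ u : ℝ → E m, Measurable u ∧ (∀ t ∈ Icc 0 T, u t ∈ S.U) ∧
      ∀ t ∈ Icc 0 T, x t = x 0 + ∫ s in (0 : ℝ)..t, ∑ i, u s i • S.g i (x s)

/-- Euclidean arc length `∫ ‖ẋ(t)‖ dt` of the piece of `x` over `[a,b]`. -/
def arcLength {N : ℕ} (x : ℝ → E N) (a b : ℝ) : ℝ≥0∞ :=
  ∫⁻ t in Icc a b, ‖deriv x t‖ₑ

/-- Sub-Riemannian distance: infimum of the arc lengths of the trajectories from `p` to `q`
(`∞` if there are none). -/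
def dist (p q : E N) : ℝ≥0∞ :=
  ⨅ (x : ℝ → E N) (T : ℝ) (_ : S.IsTrajectory x T ∧ x 0 = p ∧ x T = q), arcLength x 0 T

/-! ### Iterated brackets, growth vector, weights -/

/-- `IsBracket k Z`: `Z` is an iterated Lie bracket `[g_{i₁},[g_{i₂},…]]` with `k` terms. -/
inductive IsBracket : ℕ → (E N → E N) → Prop
  | base (i : Fin m) : IsBracket 1 (S.g i)
  | step (i : Fin m) (k : ℕ) (Z : E N → E N) (hZ : IsBracket k Z) :
      IsBracket (k + 1) (VectorField.lieBracket ℝ (S.g i) Z)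

/-- `L^k(p)`: the span at `p` of the iterated brackets with at most `k` terms. -/
def L (k : ℕ) (p : E N) : Submodule ℝ (E N) :=
  Submodule.span ℝ {v | ∃ j ≤ k, ∃ Z, S.IsBracket j Z ∧ Z p = v}

/-- `n_k(p) = dim L^k(p)`. -/
def growth (k : ℕ) (p : E N) : ℕ := Module.finrank ℝ (S.L k p)

/-- Chow's condition. -/
def BracketGenerating : Prop := ∀ p ∈ S.M, ∃ k, S.L k p = ⊤

/-- `p` is a regular point: the growth vector is constant near `p`. -/
def IsRegularPoint (p : E N) : Prop := ∀ᶠ q in 𝓝 p, ∀ k, S.growth k q = S.growth k p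

/-- The degree of nonholonomy `s(p)`, the least `k` with `L^k(p) = T_p M`. -/
def step (p : E N) : ℕ := sInf {k | S.L k p = ⊤}

/-- The weights `w_1 ≤ … ≤ w_N` at `p`: `w_i = k` iff `n_{k-1}(p) < i ≤ n_k(p)`
(with `i` counted from `1`; here indices start at `0`). -/
def weight (p : E N) (i : Fin N) : ℕ := sInf {k | (i : ℕ) < S.growth k p}

/-- The homogeneous dimension `D = ∑ w_i`. -/
def homDim (p : E N) : ℕ := ∑ i, S.weight p i

/-! ### Privileged coordinates -/

/-- Iterated derivative `g_{i₁} g_{i₂} ⋯ g_{i_k} f` of a function along the control fields. -/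
def nonholDeriv (f : E N → ℝ) : List (Fin m) → E N → ℝ
  | [] => f
  | i :: l => fun p => fderiv ℝ (nonholDeriv f l) p (S.g i p)

/-- The nonholonomic order of `f` at `p` equals `w`. -/
def HasOrder (f : E N → ℝ) (p : E N) (w : ℕ) : Prop :=
  (∀ l : List (Fin m), l.length < w → S.nonholDeriv f l p = 0) ∧
    ∃ l : List (Fin m), l.length = w ∧ S.nonholDeriv f l p ≠ 0

/-- The coordinates `z_i = y_i + poly_i(y)` around `p`, where `y` are the linear coordinates centred
at `p` in the orthonormal basis `Y`. -/
def polyCoord {N : ℕ} (p : E N) (Y : OrthonormalBasis (Fin N) ℝ (E N))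
    (poly : Fin N → MvPolynomial (Fin N) ℝ) (q : E N) (i : Fin N) : ℝ :=
  Y.repr (q - p) i + MvPolynomial.eval (fun j => Y.repr (q - p) j) (poly i)

/-- `z` is a system of privileged coordinates at `p`: an orthonormal basis of `T_p M` adapted to the
flag `L^1(p) ⊆ L^2(p) ⊆ …` gives linear coordinates `y`; `z_i = y_i + poly_i(y_1, …, y_{i-1})` with
only terms of degree at least `2` and less than `w_i` in `poly_i`; and `z_i` has order `w_i`. -/
def IsPrivileged (p : E N) (z : E N → Fin N → ℝ) : Prop :=
  ∃ (Y : OrthonormalBasis (Fin N) ℝ (E N)) (poly : Fin N → MvPolynomial (Fin N) ℝ),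
    (∀ k, Submodule.span ℝ (Y '' {i | S.weight p i ≤ k}) = S.L k p) ∧
    (∀ i, ∀ j ∈ (poly i).vars, j < i) ∧
    (∀ i, ∀ α ∈ (poly i).support, 2 ≤ α.degree ∧ α.degree < S.weight p i) ∧
    z = polyCoord p Y poly ∧
    ∀ i, S.HasOrder (fun q => z q i) p (S.weight p i)

/-- The pseudonorm `max_i |z_i|^{1/w_i}` at `p`. -/
def pseudonorm (p : E N) (z : Fin N → ℝ) : ℝ := ⨆ i, |z i| ^ (1 / (S.weight p i : ℝ))

/-- The assumptions on the system, with the constants they provide: (a) bracket generation,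
(b) only regular points, (c) the ball-box estimate with uniform constants, (d) the
comparison with the Euclidean distance with a uniform radius. -/
structure Assumptions (aMin AMax σMin θMin : ℝ) : Prop where
  bracketGenerating : S.BracketGenerating
  regular : ∀ p ∈ S.M, S.IsRegularPoint p
  aMin_pos : 0 < aMin
  aMin_le : aMin ≤ AMax
  σMin_pos : 0 < σMin
  ballBox : ∀ p ∈ S.M, ∃ z : E N → Fin N → ℝ, S.IsPrivileged p z ∧
    ∀ q ∈ S.M, S.dist p q < ENNReal.ofReal σMin →
      ENNReal.ofReal (aMin * S.pseudonorm p (z q)) ≤ S.dist p q ∧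
      S.dist p q ≤ ENNReal.ofReal (AMax * S.pseudonorm p (z q))
  θMin_pos : 0 < θMin
  distComparison : ∀ p ∈ S.M, ∀ q ∈ S.M, ‖p - q‖ ≤ θMin →
    ENNReal.ofReal ‖p - q‖ ≤ S.dist p q ∧
    S.dist p q ≤ ENNReal.ofReal (2 * AMax * ‖p - q‖ ^ (1 / (S.step p : ℝ)))

/-! ### Obstacles and clearance -/

/-- The free space: the closure, in `M`, of `M \ M_obs`. -/
def free (Mobs : Set (E N)) : Set (E N) := closure (S.M \ Mobs) ∩ S.M

/-- A collision-free `x : [0,T] → M` has strong `δ`-clearance: each of its points is at Euclidean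
distance at least `δ` from every point of `M_obs`. -/
def StrongClearance (Mobs : Set (E N)) (δ : ℝ) (x : ℝ → E N) (T : ℝ) : Prop :=
  ∀ t ∈ Icc 0 T, x t ∈ S.free Mobs ∧ ∀ q ∈ Mobs, δ ≤ ‖x t - q‖

/-! ### Tracing -/

/-- `Y : [0,R] → M` is a trajectory through `y 0, …, y k` in this order, from `y 0` to `y k`, each
piece of which is optimal up to an error `κ` in length. For `κ = 0` this is the concatenation of
optimal connections. -/
def IsConnection (κ : ℝ≥0) {k : ℕ} (y : Fin (k + 1) → E N) (Y : ℝ → E N) (R : ℝ) : Prop :=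
  S.IsTrajectory Y R ∧ ∃ τ : Fin (k + 1) → ℝ, Monotone τ ∧ τ 0 = 0 ∧ τ (Fin.last k) = R ∧
    (∀ j, Y (τ j) = y j) ∧
    ∀ j : Fin k, arcLength Y (τ j.castSucc) (τ j.succ) ≤ S.dist (y j.castSucc) (y j.succ) + κ

/-- The waypoints `y 0, …, y k` `(ε, r)`-trace the trajectory `x` on `[0,T]`.

Optimal connections need not exist (`U` need not be convex), so the conditions on the concatenated
path are required of every connection that is optimal up to some fixed error `κ > 0`; this covers
all optimal connections, and connections with any given positive error do exist. The last field
says that the waypoints follow the whole of `x`, in order; without it one waypoint near `x` would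
always trace `x`. -/
structure Traces (x : ℝ → E N) (T ε r : ℝ) {k : ℕ} (y : Fin (k + 1) → E N) : Prop where
  gap : ∀ j : Fin k, S.dist (y j.castSucc) (y j.succ) ≤ ENNReal.ofReal r
  exists_connection : ∀ κ : ℝ≥0, 0 < κ → ∃ Y R, S.IsConnection κ y Y R
  cost_and_tube : ∃ κ : ℝ≥0, 0 < κ ∧ ∀ Y R, S.IsConnection κ y Y R →
    arcLength Y 0 R ≤ ENNReal.ofReal (1 + ε) * arcLength x 0 T ∧
    ∀ s ∈ Icc 0 R, ∃ t ∈ Icc 0 T, S.dist (Y s) (x t) ≤ ENNReal.ofReal r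
  follows : ∃ t : Fin (k + 2) → ℝ, Monotone t ∧ t 0 = 0 ∧ t (Fin.last (k + 1)) = T ∧
    ∀ j : Fin (k + 1), ∀ s ∈ Icc (t j.castSucc) (t j.succ),
      S.dist (y j) (x s) ≤ ENNReal.ofReal r

/-! ### Sampling -/

/-- The law of `n` independent uniform samples from the free space. -/
def sampleFree (Mobs : Set (E N)) (n : ℕ) : Measure (Fin n → E N) :=
  Measure.pi fun _ => ProbabilityTheory.cond volume (S.free Mobs)

/-- The connection radius, for volume `vol` of the free space and homogeneous dimension `D`. -/
def radius (AMax η vol : ℝ) (D n : ℕ) : ℝ :=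
  4 * AMax * (1 + η) ^ (1 / (D : ℝ)) * (vol / D) ^ (1 / (D : ℝ)) *
    (Real.log n / n) ^ (1 / (D : ℝ))

/-- The event that some sequence of points of `V = {x_init} ∪ {v_1, …, v_n}` `(ε, r)`-traces `x`;
if `x` starts at `x_init`, so does the sequence. -/
def traceEvent (xinit : E N) (x : ℝ → E N) (T ε r : ℝ) (n : ℕ) : Set (Fin n → E N) :=
  {v | ∃ (k : ℕ) (y : Fin (k + 1) → E N), (∀ j, y j ∈ insert xinit (range v)) ∧
    S.Traces x T ε r y ∧ (x 0 = xinit → y 0 = xinit)}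

end System

end DCA

end

/-!
Mark points on `x` at equal arc-length spacing `h ≈ r / 2`. By the ball-box estimate, the ball of
control radius `A ρ` around a marked point contains the preimage of a box under a volume-preserving
triangular coordinate change, hence has volume at least `ρ ^ D`. With `r = 4 A ρ`, all balls of
radius `r / 4` around the marked points are hit by samples except with probability
`O(1 / ρ) * exp (-n ρ ^ D / μ)`, and this is the claimed rate. Such samples already satisfy
everything except the bound on the cost.

The extra cost is at most a small multiple of the length as soon as all but a small fraction of the
much smaller balls of radius `β r / 4` are hit too. These balls need not be disjoint, as `x` may
return to the same place. But the length of `x` is its variation, so the chords between finitely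
many base points on `x` almost add up to it. Between two base points, a marked point whose distance
from the first one exceeds all earlier such distances by `h / 2` is `h / 2` away from all previous
points of this kind, and only few marked points fail to be of this kind. So up to a small fraction
the marked points form boundedly many families with disjoint small balls. Missing a fixed fraction
of a family has probability at most `2 ^ M * exp (-c M log n)` for `M` marked points, which is
negligible because `M → ∞`.
-/

noncomputable section

namespace DCA

/-! ### Arc length and variation -/

section Variation

variable {F : Type*} [NormedAddCommGroup F] [NormedSpace ℝ F]

theorem norm_deriv_le_norm_deriv {G : Type*} [NormedAddCommGroup G] [NormedSpace ℝ G]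
    {x : ℝ → F} {v : ℝ → G} {t : ℝ} (hv : DifferentiableAt ℝ v t)
    (h : ∀ᶠ s in 𝓝 t, ‖x s - x t‖ ≤ ‖v s - v t‖) : ‖deriv x t‖ ≤ ‖deriv v t‖ := by
  by_cases hx : DifferentiableAt ℝ x t
  · refine le_of_tendsto_of_tendsto (hasDerivAt_iff_tendsto_slope.1 hx.hasDerivAt).norm
      (hasDerivAt_iff_tendsto_slope.1 hv.hasDerivAt).norm ?_
    filter_upwards [nhdsWithin_le_nhds h] with s hs
    simp only [slope_def_module, norm_smul]
    gcongr
  · simp [deriv_zero_of_not_differentiableAt hx]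

theorem lintegral_enorm_deriv_le_of_monotoneOn {v : ℝ → ℝ} {a b : ℝ} (hab : a ≤ b)
    (hv : MonotoneOn v (Icc a b)) :
    ∫⁻ t in Icc a b, ‖deriv v t‖ₑ ≤ ENNReal.ofReal (v b - v a) := by
  obtain ⟨G, hlim, hmeas, hle⟩ := hv.exists_tendsto_deriv_liminf_lintegral_enorm_le hab
  exact (lintegral_enorm_le_liminf_of_tendsto hlim fun n => (hmeas n).aemeasurable.enorm).trans hle

theorem lintegral_enorm_deriv_le_eVariationOn (x : ℝ → F) {a b : ℝ} (hab : a ≤ b) :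
    ∫⁻ t in Icc a b, ‖deriv x t‖ₑ ≤ eVariationOn x (Icc a b) := by
  rcases eq_or_ne (eVariationOn x (Icc a b)) ⊤ with htop | hfin
  · simp [htop]
  have hbv : LocallyBoundedVariationOn x (Icc a b) :=
    BoundedVariationOn.locallyBoundedVariationOn hfin
  have ha : a ∈ Icc a b := left_mem_Icc.2 hab
  set v : ℝ → ℝ := variationOnFromTo x (Icc a b) a
  have hmono : MonotoneOn v (Icc a b) := variationOnFromTo.monotoneOn hbv ha
  have hdist : ∀ s ∈ Icc a b, ∀ t ∈ Icc a b, ‖x s - x t‖ ≤ ‖v s - v t‖ := by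
    intro s hs t ht
    wlog hst : s ≤ t generalizing s t
    · rw [norm_sub_rev, norm_sub_rev (v s)]
      exact this t ht s hs (le_of_not_ge hst)
    rw [norm_sub_rev (v s), variationOnFromTo.sub_right hbv ha ht hs,
      variationOnFromTo.eq_of_le x _ hst, ← dist_eq_norm, dist_edist]
    refine le_trans ?_ (le_abs_self _)
    exact ENNReal.toReal_mono (hbv s t hs ht)
      (eVariationOn.edist_le x ⟨hs, left_mem_Icc.2 hst⟩ ⟨ht, right_mem_Icc.2 hst⟩)
  calc ∫⁻ t in Icc a b, ‖deriv x t‖ₑ ≤ ∫⁻ t in Icc a b, ‖deriv v t‖ₑ := by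
        rw [← restrict_Ioo_eq_restrict_Icc]
        refine setLIntegral_mono_ae' measurableSet_Ioo ?_
        filter_upwards [hmono.ae_differentiableWithinAt_of_mem] with t hdiff ht
        have hnhds : Icc a b ∈ 𝓝 t := Icc_mem_nhds ht.1 ht.2
        rw [← ofReal_norm, ← ofReal_norm]
        refine ENNReal.ofReal_le_ofReal (norm_deriv_le_norm_deriv
          ((hdiff (Ioo_subset_Icc_self ht)).differentiableAt hnhds) ?_)
        filter_upwards [hnhds] with s hs using hdist s hs t (Ioo_subset_Icc_self ht)
    _ ≤ ENNReal.ofReal (v b - v a) := lintegral_enorm_deriv_le_of_monotoneOn hab hmono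
    _ = eVariationOn x (Icc a b) := by
        rw [variationOnFromTo.sub_right hbv ha (right_mem_Icc.2 hab) ha,
          variationOnFromTo.eq_of_le x _ hab, inter_self, ENNReal.ofReal_toReal hfin]

end Variation

section ArcLength

variable {N : ℕ}

theorem arcLength_congr {x y : ℝ → E N} {a b : ℝ} (h : EqOn x y (Ioo a b)) :
    System.arcLength x a b = System.arcLength y a b := by
  unfold System.arcLength
  rw [← restrict_Ioo_eq_restrict_Icc]
  refine setLIntegral_congr_fun measurableSet_Ioo fun t ht => ?_
  simp only [(h.eventuallyEq_of_mem (Ioo_mem_nhds ht.1 ht.2)).deriv_eq]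

theorem arcLength_self (x : ℝ → E N) (a : ℝ) : System.arcLength x a a = 0 := by
  simp [System.arcLength]

theorem arcLength_le_add (x : ℝ → E N) {a b c : ℝ} (hab : a ≤ b) (hbc : b ≤ c) :
    System.arcLength x a c ≤ System.arcLength x a b + System.arcLength x b c := by
  unfold System.arcLength
  rw [← Icc_union_Icc_eq_Icc hab hbc]
  exact lintegral_union_le _ _ _

theorem arcLength_comp_const_add (x : ℝ → E N) (c a b : ℝ) :
    System.arcLength (fun t => x (c + t)) a b = System.arcLength x (c + a) (c + b) := by
  have hshift := (measurePreserving_add_left (volume : Measure ℝ) c).setLIntegral_comp_preimage_emb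
    (measurableEmbedding_addLeft c) (fun t => ‖deriv x t‖ₑ) (Icc (c + a) (c + b))
  simpa only [System.arcLength, deriv_comp_const_add, preimage_const_add_Icc, add_sub_cancel_left]
    using hshift

theorem arcLength_comp_const_sub (x : ℝ → E N) (c a b : ℝ) :
    System.arcLength (fun t => x (c - t)) a b = System.arcLength x (c - b) (c - a) := by
  have hflip :=
    (Measure.measurePreserving_sub_left (volume : Measure ℝ) c).setLIntegral_comp_preimage_emb
      (MeasurableEquiv.subLeft c).measurableEmbedding (fun t => ‖deriv x t‖ₑ) (Icc (c - b) (c - a))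
  simpa only [System.arcLength, deriv_comp_const_sub, enorm_neg, preimage_const_sub_Icc,
    sub_sub_cancel] using hflip

theorem arcLength_le_sum (x : ℝ → E N) {k : ℕ} (τ : Fin (k + 1) → ℝ) (hτ : Monotone τ) :
    System.arcLength x (τ 0) (τ (Fin.last k)) ≤
      ∑ j : Fin k, System.arcLength x (τ j.castSucc) (τ j.succ) := by
  induction k with
  | zero => simp [arcLength_self]
  | succ k ih =>
    rw [Fin.sum_univ_castSucc]
    refine (arcLength_le_add x (b := τ (Fin.last k).castSucc) (hτ (Fin.zero_le _))
      (hτ (Fin.le_last _))).trans ?_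
    exact add_le_add_left (ih (fun j => τ j.castSucc) fun i j h => hτ (by simpa using h)) _

end ArcLength

namespace System

/-! ### Paths with integrable velocity -/

/-- `x` is absolutely continuous on `[0,T]` with velocity `f`: the trajectories of a system are
paths of this kind, and their arc length is the integral of `‖f‖`. -/
structure HasVelocity {F : Type*} [NormedAddCommGroup F] [NormedSpace ℝ F] (x f : ℝ → F)
    (T : ℝ) : Prop where
  nonneg : 0 ≤ T
  intervalIntegrable : IntervalIntegrable f volume 0 T
  eq_add_integral : ∀ t ∈ Icc 0 T, x t = x 0 + ∫ s in (0 : ℝ)..t, f s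

namespace HasVelocity

section NormedSpace

variable {F : Type*} [NormedAddCommGroup F] [NormedSpace ℝ F] {x y f g : ℝ → F} {T T₁ T₂ a b : ℝ}

theorem mono_intervalIntegrable (h : HasVelocity x f T) (ha : a ∈ Icc 0 T) (hb : b ∈ Icc 0 T) :
    IntervalIntegrable f volume a b :=
  h.intervalIntegrable.mono_set (by rw [uIcc_of_le h.nonneg]; exact uIcc_subset_Icc ha hb)

theorem sub_eq_integral (h : HasVelocity x f T) (ha : a ∈ Icc 0 T) (hb : b ∈ Icc 0 T) :
    x b - x a = ∫ s in a..b, f s := by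
  have h0 : (0 : ℝ) ∈ Icc 0 T := left_mem_Icc.2 h.nonneg
  rw [h.eq_add_integral b hb, h.eq_add_integral a ha, add_sub_add_left_eq_sub]
  exact intervalIntegral.integral_interval_sub_left (h.mono_intervalIntegrable h0 hb)
    (h.mono_intervalIntegrable h0 ha)

theorem congr (h : HasVelocity x f T) (hxy : EqOn x y (Icc 0 T)) (hfg : EqOn f g (Ioo 0 T)) :
    HasVelocity y g T where
  nonneg := h.nonneg
  intervalIntegrable := h.intervalIntegrable.congr_uIoo (by rwa [uIoo_of_le h.nonneg])
  eq_add_integral t ht := by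
    rw [← hxy ht, ← hxy (left_mem_Icc.2 h.nonneg), h.eq_add_integral t ht]
    congr 1
    exact intervalIntegral.integral_congr_Ioo_of_le ht.1
      (hfg.mono (Ioo_subset_Ioo_right ht.2))

theorem restrict (h : HasVelocity x f T) (ha : 0 ≤ a) (hab : a ≤ b) (hb : b ≤ T) :
    HasVelocity (fun t => x (a + t)) (fun t => f (a + t)) (b - a) where
  nonneg := sub_nonneg.2 hab
  intervalIntegrable := by
    simpa using (h.mono_intervalIntegrable ⟨ha, hab.trans hb⟩ ⟨ha.trans hab, hb⟩).comp_add_left a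
  eq_add_integral t ht := by
    rw [← sub_eq_iff_eq_add', add_zero, h.sub_eq_integral ⟨ha, hab.trans hb⟩
      ⟨add_nonneg ha ht.1, by linarith [ht.2]⟩, intervalIntegral.integral_comp_add_left, add_zero]

theorem reverse (h : HasVelocity x f T) :
    HasVelocity (fun t => x (T - t)) (fun t => -f (T - t)) T where
  nonneg := h.nonneg
  intervalIntegrable := by
    simpa using! (h.intervalIntegrable.comp_sub_left T).symm.neg
  eq_add_integral t ht := by
    rw [← sub_eq_iff_eq_add', sub_zero, intervalIntegral.integral_neg,
      intervalIntegral.integral_comp_sub_left, sub_zero,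
      ← h.sub_eq_integral ⟨sub_nonneg.2 ht.2, sub_le_self T ht.1⟩ (right_mem_Icc.2 h.nonneg),
      neg_sub]

theorem append (h₁ : HasVelocity x f T₁)
    (h₂ : HasVelocity (fun t => x (T₁ + t)) (fun t => f (T₁ + t)) T₂) :
    HasVelocity x f (T₁ + T₂) := by
  have hint : ∀ t ∈ Icc 0 T₂, IntervalIntegrable f volume T₁ (T₁ + t) := fun t ht => by
    simpa [add_comm t] using
      (h₂.mono_intervalIntegrable (left_mem_Icc.2 h₂.nonneg) ht).comp_sub_right T₁
  refine ⟨add_nonneg h₁.nonneg h₂.nonneg,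
    h₁.intervalIntegrable.trans (hint T₂ (right_mem_Icc.2 h₂.nonneg)), fun t ht => ?_⟩
  rcases le_total t T₁ with htT | htT
  · exact h₁.eq_add_integral t ⟨ht.1, htT⟩
  have hmem : t - T₁ ∈ Icc 0 T₂ := ⟨sub_nonneg.2 htT, by linarith [ht.2]⟩
  have hlate := h₂.eq_add_integral _ hmem
  rw [add_sub_cancel, add_zero, intervalIntegral.integral_comp_add_left, add_zero,
    add_sub_cancel] at hlate
  have hint' := hint _ hmem
  rw [add_sub_cancel] at hint'
  rw [hlate, h₁.eq_add_integral T₁ (right_mem_Icc.2 h₁.nonneg), add_assoc,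
    intervalIntegral.integral_add_adjacent_intervals h₁.intervalIntegrable hint']

end NormedSpace

variable {N : ℕ} {x f : ℝ → E N} {T a b : ℝ}

theorem ae_deriv_eq (h : HasVelocity x f T) : ∀ᵐ t, t ∈ Ioo 0 T → deriv x t = f t := by
  filter_upwards [h.intervalIntegrable.ae_hasDerivAt_integral] with t ht hmem
  have hd := (ht (by rw [uIcc_of_le h.nonneg]; exact Ioo_subset_Icc_self hmem) 0
    left_mem_uIcc).const_add (x 0)
  have heq : x =ᶠ[𝓝 t] fun t => x 0 + ∫ s in (0 : ℝ)..t, f s := by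
    filter_upwards [Ioo_mem_nhds hmem.1 hmem.2] with s hs
    exact h.eq_add_integral s (Ioo_subset_Icc_self hs)
  rw [heq.deriv_eq, hd.deriv]

theorem arcLength_eq_ofReal (h : HasVelocity x f T) (ha : 0 ≤ a) (hab : a ≤ b) (hb : b ≤ T) :
    arcLength x a b = ENNReal.ofReal (∫ t in a..b, ‖f t‖) := by
  have hint : IntegrableOn f (Ioo a b) :=
    (h.mono_intervalIntegrable ⟨ha, hab.trans hb⟩ ⟨ha.trans hab, hb⟩).1.mono_set Ioo_subset_Ioc_self
  rw [arcLength, ← restrict_Ioo_eq_restrict_Icc, intervalIntegral.integral_of_le hab,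
    integral_Ioc_eq_integral_Ioo, ofReal_integral_norm_eq_lintegral_enorm hint]
  refine setLIntegral_congr_fun_ae measurableSet_Ioo ?_
  filter_upwards [h.ae_deriv_eq] with t ht hmem
  rw [ht ⟨ha.trans_lt hmem.1, hmem.2.trans_le hb⟩]

end HasVelocity

/-! ### Trajectories -/

variable {N m : ℕ} {S : System N m} {x : ℝ → E N} {T : ℝ}

/-- The velocity field `∑ i, u_i(s) g_i(x(s))` prescribed along `x` by the control `u`. -/
def velocity (S : System N m) (u : ℝ → E m) (x : ℝ → E N) (s : ℝ) : E N :=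
  ∑ i, u s i • S.g i (x s)

theorem integrableOn_velocity {u : ℝ → E m} {K : Set ℝ} (hK : IsCompact K)
    (hc : ContinuousOn x K) (hM : ∀ t ∈ K, x t ∈ S.M) (hu : Measurable u)
    (hU : ∀ t ∈ K, u t ∈ S.U) : IntegrableOn (S.velocity u x) K := by
  obtain ⟨C, hC⟩ := S.isBounded_U.exists_norm_le
  refine integrable_finsetSum _ fun i _ => ?_
  have hg : ContinuousOn (fun s => S.g i (x s)) K := (S.smooth_g i).continuousOn.comp hc hM
  refine (hg.integrableOn_compact hK).bdd_smul C (φ := fun s => u s i) ?_ ?_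
  · exact ((EuclideanSpace.proj (𝕜 := ℝ) i).continuous.measurable.comp hu).aestronglyMeasurable
  · exact ae_restrict_of_forall_mem hK.measurableSet fun t ht =>
      (PiLp.norm_apply_le (u t) i).trans (hC _ (hU t ht))

theorem IsTrajectory.of_hasVelocity {u : ℝ → E m} (hc : ContinuousOn x (Icc 0 T))
    (hM : ∀ t ∈ Icc 0 T, x t ∈ S.M) (hu : Measurable u) (hU : ∀ t ∈ Icc 0 T, u t ∈ S.U)
    (h : HasVelocity x (S.velocity u x) T) : S.IsTrajectory x T :=
  ⟨h.nonneg, hc, hM, u, hu, hU, h.eq_add_integral⟩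

theorem IsTrajectory.exists_control (hx : S.IsTrajectory x T) :
    ∃ u : ℝ → E m, Measurable u ∧ (∀ t ∈ Icc 0 T, u t ∈ S.U) ∧
      HasVelocity x (S.velocity u x) T := by
  obtain ⟨hT, hc, hM, u, hu, hU, h⟩ := hx
  refine ⟨u, hu, hU, hT, ?_, h⟩
  exact (intervalIntegrable_iff_integrableOn_Icc_of_le hT).2
    (integrableOn_velocity isCompact_Icc hc hM hu hU)

theorem IsTrajectory.restrict (hx : S.IsTrajectory x T) {a b : ℝ} (ha : 0 ≤ a) (hab : a ≤ b)
    (hb : b ≤ T) : S.IsTrajectory (fun t => x (a + t)) (b - a) := by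
  obtain ⟨u, hu, hU, h⟩ := hx.exists_control
  have hmem : ∀ t ∈ Icc 0 (b - a), a + t ∈ Icc 0 T := fun t ht =>
    ⟨add_nonneg ha ht.1, by linarith [ht.2]⟩
  exact .of_hasVelocity (hx.2.1.comp (by fun_prop) hmem) (fun t ht => hx.2.2.1 _ (hmem t ht))
    (hu.comp (measurable_const_add a)) (fun t ht => hU _ (hmem t ht)) (h.restrict ha hab hb)

theorem IsTrajectory.reverse (hx : S.IsTrajectory x T) : S.IsTrajectory (fun t => x (T - t)) T := by
  obtain ⟨u, hu, hU, h⟩ := hx.exists_control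
  have hmem : ∀ t ∈ Icc 0 T, T - t ∈ Icc 0 T := fun t ht =>
    ⟨sub_nonneg.2 ht.2, sub_le_self T ht.1⟩
  refine .of_hasVelocity (hx.2.1.comp (by fun_prop) hmem) (fun t ht => hx.2.2.1 _ (hmem t ht))
    (hu.comp (measurable_const_sub T)).neg (fun t ht => S.symm_U _ (hU _ (hmem t ht)))
    (h.reverse.congr (fun _ _ => rfl) fun t _ => ?_)
  simp [velocity]

theorem isTrajectory_const {p : E N} (hp : p ∈ S.M) : S.IsTrajectory (fun _ => p) 0 := by
  obtain ⟨v, hv⟩ : S.U.Nonempty := by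
    rw [← convexHull_nonempty_iff (𝕜 := ℝ)]
    exact ⟨0, interior_subset S.zero_mem_U⟩
  refine ⟨le_rfl, continuousOn_const, fun _ _ => hp, fun _ => v, measurable_const,
    fun _ _ => hv, fun t ht => ?_⟩
  obtain rfl : t = 0 := le_antisymm ht.2 ht.1
  simp

section Concat

variable {α : Type*} {x y : ℝ → α} {T t : ℝ}

/-- The path that follows `x` up to time `T` and `y`, started at time `T`, from then on. -/
def concat {α : Type*} (x : ℝ → α) (T : ℝ) (y : ℝ → α) (t : ℝ) : α :=
  if t ≤ T then x t else y (t - T)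

theorem concat_of_le (ht : t ≤ T) : concat x T y t = x t := if_pos ht

theorem concat_add_of_pos (ht : 0 < t) : concat x T y (T + t) = y t := by
  rw [concat, if_neg (not_le.2 (lt_add_of_pos_right T ht)), add_sub_cancel_left]

theorem concat_add (h : x T = y 0) (ht : 0 ≤ t) : concat x T y (T + t) = y t := by
  rcases ht.eq_or_lt with rfl | ht
  · rw [add_zero, concat_of_le le_rfl, h]
  · exact concat_add_of_pos ht

theorem forall_mem_Icc_add {p : ℝ → Prop} {T₁ T₂ : ℝ} (h₁ : ∀ t ∈ Icc 0 T₁, p t)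
    (h₂ : ∀ t ∈ Ioc 0 T₂, p (T₁ + t)) : ∀ t ∈ Icc 0 (T₁ + T₂), p t := by
  intro t ht
  rcases le_or_gt t T₁ with h | h
  · exact h₁ t ⟨ht.1, h⟩
  · simpa using h₂ (t - T₁) ⟨sub_pos.2 h, by linarith [ht.2]⟩

end Concat

theorem arcLength_concat_left (x y : ℝ → E N) {T a b : ℝ} (hb : b ≤ T) :
    arcLength (concat x T y) a b = arcLength x a b :=
  arcLength_congr fun _ ht => concat_of_le (ht.2.le.trans hb)

theorem arcLength_concat_right (x y : ℝ → E N) (T : ℝ) {a : ℝ} (ha : 0 ≤ a) (b : ℝ) :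
    arcLength (concat x T y) (T + a) (T + b) = arcLength y a b := by
  rw [← arcLength_comp_const_add]
  exact arcLength_congr fun t ht => concat_add_of_pos (ha.trans_lt ht.1)

theorem IsTrajectory.concat {x₁ x₂ : ℝ → E N} {T₁ T₂ : ℝ} (h₁ : S.IsTrajectory x₁ T₁)
    (h₂ : S.IsTrajectory x₂ T₂) (h : x₁ T₁ = x₂ 0) :
    S.IsTrajectory (concat x₁ T₁ x₂) (T₁ + T₂) := by
  obtain ⟨u₁, hu₁, hU₁, hv₁⟩ := h₁.exists_control
  obtain ⟨u₂, hu₂, hU₂, hv₂⟩ := h₂.exists_control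
  have hsub : ∀ t ∈ Icc T₁ (T₁ + T₂), t - T₁ ∈ Icc 0 T₂ := fun t ht =>
    ⟨sub_nonneg.2 ht.1, by linarith [ht.2]⟩
  refine .of_hasVelocity (u := System.concat u₁ T₁ u₂) ?_
    (forall_mem_Icc_add (fun t ht => ?_) fun t ht => ?_)
    (.ite measurableSet_Iic hu₁ (hu₂.comp (measurable_sub_const T₁)))
    (forall_mem_Icc_add (fun t ht => ?_) fun t ht => ?_) (HasVelocity.append ?_ ?_)
  · rw [← Icc_union_Icc_eq_Icc h₁.1 (le_add_of_nonneg_right h₂.1)]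
    refine (h₁.2.1.congr fun t ht => concat_of_le ht.2).union_of_isClosed
      ((h₂.2.1.comp (by fun_prop) hsub).congr fun t ht => ?_) isClosed_Icc isClosed_Icc
    simpa using concat_add h (hsub t ht).1
  · rw [concat_of_le ht.2]; exact h₁.2.2.1 t ht
  · rw [concat_add_of_pos ht.1]; exact h₂.2.2.1 t (Ioc_subset_Icc_self ht)
  · rw [concat_of_le ht.2]; exact hU₁ t ht
  · rw [concat_add_of_pos ht.1]; exact hU₂ t (Ioc_subset_Icc_self ht)
  · refine hv₁.congr (fun t ht => (concat_of_le ht.2).symm) fun t ht => ?_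
    simp only [velocity, concat_of_le ht.2.le]
  · refine hv₂.congr (fun t ht => (concat_add h ht.1).symm) fun t ht => ?_
    simp only [velocity, concat_add_of_pos ht.1]

/-! ### The sub-Riemannian distance -/

theorem IsTrajectory.dist_le (hx : S.IsTrajectory x T) : S.dist (x 0) (x T) ≤ arcLength x 0 T :=
  iInf_le_of_le x (iInf_le_of_le T (iInf_le_of_le ⟨hx, rfl, rfl⟩ le_rfl))

theorem IsTrajectory.dist_le_arcLength (hx : S.IsTrajectory x T) {a b : ℝ} (ha : 0 ≤ a)
    (hab : a ≤ b) (hb : b ≤ T) : S.dist (x a) (x b) ≤ arcLength x a b := by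
  simpa [arcLength_comp_const_add] using (hx.restrict ha hab hb).dist_le

theorem exists_trajectory_of_dist_lt {p q : E N} {c : ℝ≥0∞} (h : S.dist p q < c) :
    ∃ x T, S.IsTrajectory x T ∧ x 0 = p ∧ x T = q ∧ arcLength x 0 T < c := by
  simp only [dist, iInf_lt_iff] at h
  obtain ⟨x, T, ⟨hx, h0, hT⟩, hlt⟩ := h
  exact ⟨x, T, hx, h0, hT, hlt⟩

theorem mem_of_dist_ne_top {p q : E N} (h : S.dist p q ≠ ⊤) : p ∈ S.M ∧ q ∈ S.M := by
  obtain ⟨x, T, hx, rfl, rfl, -⟩ := exists_trajectory_of_dist_lt h.lt_top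
  exact ⟨hx.2.2.1 0 (left_mem_Icc.2 hx.1), hx.2.2.1 T (right_mem_Icc.2 hx.1)⟩

theorem dist_self {p : E N} (hp : p ∈ S.M) : S.dist p p = 0 :=
  le_antisymm ((isTrajectory_const hp).dist_le.trans (arcLength_self _ _).le) zero_le

theorem dist_comm (p q : E N) : S.dist p q = S.dist q p := by
  suffices h : ∀ p q : E N, S.dist q p ≤ S.dist p q from le_antisymm (h q p) (h p q)
  intro p q
  refine le_of_forall_gt fun c hc => ?_
  obtain ⟨x, T, hx, rfl, rfl, hlt⟩ := exists_trajectory_of_dist_lt hc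
  have hrev := hx.reverse.dist_le
  rw [arcLength_comp_const_sub] at hrev
  simpa using hrev.trans_lt (by simpa using hlt)

theorem dist_triangle (p q s : E N) : S.dist p s ≤ S.dist p q + S.dist q s := by
  refine ENNReal.le_of_forall_pos_le_add fun e he hfin => ?_
  have he2 : (e / 2 : ℝ≥0∞) ≠ 0 := by simpa using he.ne'
  obtain ⟨hpq, hqs⟩ := ENNReal.add_ne_top.1 hfin.ne
  obtain ⟨x, T, hx, rfl, rfl, hxlt⟩ :=
    exists_trajectory_of_dist_lt (ENNReal.lt_add_right hpq he2)
  obtain ⟨y, R, hy, hy0, rfl, hylt⟩ :=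
    exists_trajectory_of_dist_lt (ENNReal.lt_add_right hqs he2)
  have hle := (hx.concat hy hy0.symm).dist_le
  rw [concat_of_le hx.1, concat_add hy0.symm hy.1] at hle
  calc S.dist (x 0) (y R) ≤ arcLength (concat x T y) 0 (T + R) := hle
    _ ≤ arcLength (concat x T y) 0 T + arcLength (concat x T y) (T + 0) (T + R) := by
        rw [add_zero]; exact arcLength_le_add _ hx.1 (le_add_of_nonneg_right hy.1)
    _ = arcLength x 0 T + arcLength y 0 R := by
        rw [arcLength_concat_left _ _ le_rfl, arcLength_concat_right _ _ _ le_rfl]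
    _ ≤ (S.dist (x 0) (x T) + e / 2) + (S.dist (x T) (y R) + e / 2) := by gcongr
    _ = S.dist (x 0) (x T) + S.dist (x T) (y R) + e := by
        rw [add_add_add_comm, ENNReal.add_halves]

theorem IsTrajectory.norm_sub_le_arcLength (hx : S.IsTrajectory x T) :
    ENNReal.ofReal ‖x 0 - x T‖ ≤ arcLength x 0 T := by
  obtain ⟨u, -, -, h⟩ := hx.exists_control
  rw [h.arcLength_eq_ofReal le_rfl hx.1 le_rfl, norm_sub_rev,
    h.sub_eq_integral (left_mem_Icc.2 hx.1) (right_mem_Icc.2 hx.1)]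
  exact ENNReal.ofReal_le_ofReal (intervalIntegral.norm_integral_le_integral_norm hx.1)

theorem norm_sub_le_dist (p q : E N) : ENNReal.ofReal ‖p - q‖ ≤ S.dist p q :=
  le_iInf fun _ => le_iInf fun _ => le_iInf fun ⟨hx, h0, hT⟩ => by
    simpa [h0, hT] using hx.norm_sub_le_arcLength

/-! ### Connections -/

theorem isConnection_zero {κ : ℝ≥0} {y : Fin 1 → E N} (hy : y 0 ∈ S.M) :
    S.IsConnection κ y (fun _ => y 0) 0 :=
  ⟨isTrajectory_const hy, fun _ => 0, monotone_const, rfl, rfl,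
    fun j => by rw [Fin.fin_one_eq_zero j], fun j => j.elim0⟩

theorem IsConnection.cons {κ : ℝ≥0} {k : ℕ} {y : Fin (k + 1) → E N} {Y : ℝ → E N} {R : ℝ}
    (hY : S.IsConnection κ y Y R) (hx : S.IsTrajectory x T) (hxT : x T = y 0)
    (hlen : arcLength x 0 T ≤ S.dist (x 0) (y 0) + κ) :
    S.IsConnection κ (Fin.cons (x 0) y : Fin (k + 2) → E N) (concat x T Y) (T + R) := by
  obtain ⟨htraj, τ, hmono, h0, hR, hval, hlenY⟩ := hY
  have hτ : ∀ j, 0 ≤ τ j := fun j => h0 ▸ hmono (Fin.zero_le j)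
  have hY0 : x T = Y 0 := by rw [hxT, ← h0, hval]
  refine ⟨hx.concat htraj hY0, Fin.cons 0 fun j => T + τ j, Fin.monotone_iff_le_succ.2 ?_, rfl,
    ?_, ?_, ?_⟩
  · refine Fin.cases ?_ fun j => ?_
    · simpa [h0] using hx.1
    · simpa using hmono j.castSucc_le_succ
  · rw [← Fin.succ_last, Fin.cons_succ, hR]
  · refine Fin.cases (by simpa using concat_of_le hx.1) fun j => ?_
    simpa only [Fin.cons_succ, hval] using concat_add hY0 (hτ j)
  · refine Fin.cases ?_ fun j => ?_
    · simpa [h0, arcLength_concat_left] using hlen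
    · simpa only [← Fin.succ_castSucc, Fin.cons_succ, arcLength_concat_right _ _ _ (hτ _)]
        using hlenY j

theorem exists_isConnection {κ : ℝ≥0} (hκ : 0 < κ) {k : ℕ} (y : Fin (k + 1) → E N)
    (hy : y 0 ∈ S.M) (hd : ∀ j : Fin k, S.dist (y j.castSucc) (y j.succ) ≠ ⊤) :
    ∃ Y R, S.IsConnection κ y Y R := by
  induction k with
  | zero => exact ⟨_, _, isConnection_zero hy⟩
  | succ k ih =>
    obtain ⟨Y, R, hY⟩ := ih (Fin.tail y) (mem_of_dist_ne_top (hd 0)).2 fun j => hd j.succ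
    obtain ⟨x, T, hx, hx0, hxT, hlt⟩ := exists_trajectory_of_dist_lt
      (ENNReal.lt_add_right (hd 0) (ENNReal.coe_ne_zero.2 hκ.ne'))
    have hcons := hY.cons hx hxT (hx0.symm ▸ hlt.le)
    rw [hx0, Fin.castSucc_zero, Fin.cons_self_tail] at hcons
    exact ⟨_, _, hcons⟩

end System

/-! ### Triangular coordinate changes -/

section Triangular

variable {ι : Type*} [DecidableEq ι]

/-- The homeomorphism `y ↦ y + P y • e_i` of `ι → ℝ`, for a function `P` that does not depend on
the `i`-th coordinate. -/
def shear (i : ι) (P : (ι → ℝ) → ℝ) (hP : Continuous P)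
    (hi : ∀ y c, P (Function.update y i c) = P y) : (ι → ℝ) ≃ₜ (ι → ℝ) where
  toFun y := Function.update y i (y i + P y)
  invFun y := Function.update y i (y i - P y)
  left_inv y := by simp [hi]
  right_inv y := by simp [hi]
  continuous_toFun := continuous_id.update i ((continuous_apply i).add hP)
  continuous_invFun := continuous_id.update i ((continuous_apply i).sub hP)

theorem shear_apply (i : ι) (P : (ι → ℝ) → ℝ) (hP : Continuous P)
    (hi : ∀ y c, P (Function.update y i c) = P y) (y : ι → ℝ) :
    shear i P hP hi y = Function.update y i (y i + P y) := rfl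

theorem measurePreserving_shear [Fintype ι] (i : ι) (P : (ι → ℝ) → ℝ) (hP : Continuous P)
    (hi : ∀ y c, P (Function.update y i c) = P y) : MeasurePreserving (shear i P hP hi) := by
  have hmeas : Measurable (shear i P hP hi) := (shear i P hP hi).continuous.measurable
  refine ⟨hmeas, (Measure.pi_eq fun s hs => ?_).symm⟩
  have hbox : MeasurableSet (univ.pi s) := .pi countable_univ fun i _ => hs i
  simp_rw [← Measure.pi_pi, ← lintegral_indicator_one hbox]
  rw [lintegral_map (measurable_one.indicator hbox) hmeas, volume_pi]
  refine lintegral_eq_of_lmarginal_eq {i} ((measurable_one.indicator hbox).comp hmeas)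
    (measurable_one.indicator hbox) ?_
  ext y
  simp [lmarginal_singleton, shear_apply, hi,
    lintegral_add_right_eq_self fun c => indicator (univ.pi s) 1 (Function.update y i c)]

theorem exists_triangular_homeomorph {ι : Type*} [Fintype ι] [LinearOrder ι]
    (P : ι → (ι → ℝ) → ℝ) (hP : ∀ i, Continuous (P i))
    (hdep : ∀ i j, i ≤ j → ∀ y c, P i (Function.update y j c) = P i y) :
    ∃ e : (ι → ℝ) ≃ₜ (ι → ℝ), (∀ y i, e y i = y i + P i y) ∧ MeasurePreserving e := by
  suffices h : ∀ s : Finset ι, ∃ e : (ι → ℝ) ≃ₜ (ι → ℝ),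
      (∀ y i, e y i = if i ∈ s then y i + P i y else y i) ∧ MeasurePreserving e by
    simpa using h Finset.univ
  intro s
  induction s using Finset.induction_on_max with
  | empty => exact ⟨Homeomorph.refl _, by simp, MeasurePreserving.id _⟩
  | insert j s hj ih =>
    obtain ⟨e, he, hmp⟩ := ih
    have hj' : j ∉ s := fun h => lt_irrefl j (hj j h)
    refine ⟨(shear j (P j) (hP j) (hdep j j le_rfl)).trans e, fun y i => ?_,
      hmp.comp (measurePreserving_shear j (P j) (hP j) (hdep j j le_rfl))⟩
    rw [Homeomorph.trans_apply, shear_apply, he]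
    rcases eq_or_ne i j with rfl | hij
    · simp [hj']
    · rw [Function.update_of_ne hij]
      simp only [Finset.mem_insert, hij, false_or]
      split_ifs with hi
      · rw [hdep i j (hj i hi).le]
      · rfl

end Triangular

namespace System

variable {N m : ℕ} {S : System N m} {x : ℝ → E N} {T : ℝ}

theorem IsPrivileged.exists_homeomorph {p : E N} {z : E N → Fin N → ℝ} (hz : S.IsPrivileged p z) :
    ∃ Φ : E N ≃ₜ (Fin N → ℝ), (∀ q, Φ q = z q) ∧ MeasurePreserving Φ := by
  obtain ⟨Y, poly, -, hvars, -, rfl, -⟩ := hz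
  obtain ⟨e, he, hmp⟩ := exists_triangular_homeomorph
    (fun i y => MvPolynomial.eval y (poly i)) (fun i => MvPolynomial.continuous_eval (poly i))
    fun i j hij y c => MvPolynomial.eval₂Hom_congr' rfl
      (fun l hl _ => Function.update_of_ne ((hvars i l hl).trans_le hij).ne _ _) rfl
  refine ⟨((Homeomorph.subRight p).trans Y.repr.toHomeomorph).trans
    ((PiLp.homeomorph 2 (fun _ : Fin N => ℝ)).trans e), fun q => funext fun i => he _ i, ?_⟩
  exact hmp.comp ((PiLp.volume_preserving_ofLp (Fin N)).comp
    (Y.measurePreserving_repr.comp (measurePreserving_sub_right volume p)))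

theorem IsPrivileged.apply_self {p : E N} {z : E N → Fin N → ℝ} (hz : S.IsPrivileged p z) :
    z p = 0 := by
  obtain ⟨Y, poly, -, -, hdeg, rfl, -⟩ := hz
  ext i
  have hcoeff : MvPolynomial.coeff 0 (poly i) = 0 := by
    by_contra hne
    simpa using (hdeg i 0 (MvPolynomial.mem_support_iff.2 hne)).1
  rw [← MvPolynomial.constantCoeff_eq] at hcoeff
  simpa [polyCoord, ← Pi.zero_def, MvPolynomial.eval_zero'] using hcoeff

/-! ### Weights -/

theorem L_zero (p : E N) : S.L 0 p = ⊥ := by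
  have hpos : ∀ k Z, S.IsBracket k Z → k ≠ 0 := by
    rintro k Z (_ | _) <;> simp
  rw [L, Submodule.span_eq_bot]
  rintro _ ⟨j, hj, Z, hZ, rfl⟩
  exact absurd (Nat.le_zero.1 hj) (hpos j Z hZ)

theorem growth_zero (p : E N) : S.growth 0 p = 0 := by
  rw [growth, L_zero, finrank_bot]

theorem weight_pos (hb : S.BracketGenerating) {p : E N} (hp : p ∈ S.M) (i : Fin N) :
    0 < S.weight p i := by
  obtain ⟨k, hk⟩ := hb p hp
  have hfull : S.growth k p = N := by rw [growth, hk, finrank_top, finrank_euclideanSpace_fin]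
  have hmem : (i : ℕ) < S.growth (S.weight p i) p :=
    Nat.sInf_mem (s := {k | (i : ℕ) < S.growth k p}) ⟨k, i.2.trans_eq hfull.symm⟩
  rw [Nat.pos_iff_ne_zero]
  intro h0
  simp [h0, growth_zero] at hmem

theorem step_pos [NeZero N] (hb : S.BracketGenerating) {p : E N} (hp : p ∈ S.M) :
    0 < S.step p := by
  have hmem : S.L (S.step p) p = ⊤ := Nat.sInf_mem (s := {k | S.L k p = ⊤}) (hb p hp)
  rw [Nat.pos_iff_ne_zero]
  intro h0
  rw [h0, L_zero] at hmem
  exact bot_ne_top hmem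

theorem homDim_pos [NeZero N] (hb : S.BracketGenerating) {p : E N} (hp : p ∈ S.M) :
    0 < S.homDim p :=
  Finset.sum_pos (fun i _ => weight_pos hb hp i) Finset.univ_nonempty

theorem IsRegularPoint.eventually_homDim_eq {p : E N} (hp : S.IsRegularPoint p) :
    ∀ᶠ q in 𝓝 p, S.homDim q = S.homDim p :=
  hp.mono fun q hq => by simp only [homDim, weight, hq]

theorem IsTrajectory.homDim_eq (hx : S.IsTrajectory x T)
    (hreg : ∀ p ∈ S.M, S.IsRegularPoint p) {t : ℝ} (ht : t ∈ Icc 0 T) :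
    S.homDim (x t) = S.homDim (x 0) := by
  refine isPreconnected_Icc.constant (f := fun t => S.homDim (x t)) (fun s hs => ?_) ht
    (left_mem_Icc.2 hx.1)
  exact tendsto_nhds_of_eventually_eq
    (hx.2.1 s hs ((hreg _ (hx.2.2.1 s hs)).eventually_homDim_eq))

/-! ### Boxes -/

/-- The box `{v | ∀ i, |v_i| ≤ ρ ^ w_i}`, the ball of radius `ρ` for the pseudonorm with
weights `w`. -/
def box {ι : Type*} (w : ι → ℕ) (ρ : ℝ) : Set (ι → ℝ) :=
  Icc (fun i => -ρ ^ w i) (fun i => ρ ^ w i)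

theorem volume_box {ι : Type*} [Fintype ι] (w : ι → ℕ) {ρ : ℝ} (hρ : 0 ≤ ρ) :
    volume (box w ρ) = ENNReal.ofReal (2 ^ Fintype.card ι * ρ ^ ∑ i, w i) := by
  rw [box, Real.volume_Icc_pi, ← ENNReal.ofReal_prod_of_nonneg fun i _ => by
    linarith [pow_nonneg hρ (w i)]]
  simp [← two_mul, Finset.prod_mul_distrib, Finset.prod_pow_eq_pow_sum]

theorem measurableSet_box {ι : Type*} [Finite ι] (w : ι → ℕ) (ρ : ℝ) :
    MeasurableSet (box w ρ) := measurableSet_Icc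

theorem zero_mem_box {ι : Type*} (w : ι → ℕ) {ρ : ℝ} (hρ : 0 ≤ ρ) : 0 ∈ box w ρ :=
  ⟨fun i => by simpa using pow_nonneg hρ (w i), fun i => pow_nonneg hρ (w i)⟩

theorem pseudonorm_le_of_mem_box {p : E N} (hw : ∀ i, 0 < S.weight p i) {ρ : ℝ} (hρ : 0 ≤ ρ)
    {v : Fin N → ℝ} (hv : v ∈ box (S.weight p) ρ) : S.pseudonorm p v ≤ ρ := by
  refine Real.iSup_le (fun i => ?_) hρ
  calc |v i| ^ (1 / (S.weight p i : ℝ))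
      ≤ (ρ ^ S.weight p i) ^ (1 / (S.weight p i : ℝ)) := by
        gcongr
        exact abs_le.2 ⟨hv.1 i, hv.2 i⟩
    _ = ρ := by rw [one_div, Real.pow_rpow_inv_natCast hρ (hw i).ne']

namespace Assumptions

variable {aMin AMax σMin θMin : ℝ}

theorem AMax_pos (hS : S.Assumptions aMin AMax σMin θMin) : 0 < AMax :=
  hS.aMin_pos.trans_le hS.aMin_le

theorem eventually_dist_lt [NeZero N] (hS : S.Assumptions aMin AMax σMin θMin) {p : E N}
    (hp : p ∈ S.M) {c : ℝ≥0∞} (hc : 0 < c) : ∀ᶠ q in 𝓝 p, S.dist p q < c := by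
  have hs : 0 < 1 / (S.step p : ℝ) :=
    one_div_pos.2 (Nat.cast_pos.2 (step_pos hS.bracketGenerating hp))
  have hlim : Tendsto (fun q => ENNReal.ofReal (2 * AMax * ‖p - q‖ ^ (1 / (S.step p : ℝ))))
      (𝓝 p) (𝓝 0) := by
    have hcont : Continuous fun q : E N =>
        ENNReal.ofReal (2 * AMax * ‖p - q‖ ^ (1 / (S.step p : ℝ))) :=
      ENNReal.continuous_ofReal.comp (continuous_const.mul
        ((continuous_const.sub continuous_id).norm.rpow_const fun _ => .inr hs.le))
    have htendsto := hcont.tendsto p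
    rwa [sub_self, norm_zero, Real.zero_rpow hs.ne', mul_zero, ENNReal.ofReal_zero] at htendsto
  filter_upwards [hlim.eventually_lt_const hc, S.isOpen_M.mem_nhds hp,
    Metric.closedBall_mem_nhds p hS.θMin_pos] with q hq hqM hqθ
  rw [Metric.mem_closedBall, dist_eq_norm, norm_sub_rev] at hqθ
  exact (hS.distComparison p hp q hqM hqθ).2.trans_lt hq

theorem isOpen_dist_lt [NeZero N] (hS : S.Assumptions aMin AMax σMin θMin) (p : E N) (c : ℝ≥0∞) :
    IsOpen {q | S.dist p q < c} := by
  rw [isOpen_iff_eventually]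
  intro q (hq : S.dist p q < c)
  filter_upwards [hS.eventually_dist_lt (mem_of_dist_ne_top hq.ne_top).2 (tsub_pos_of_lt hq)]
    with q' hq'
  exact (dist_triangle p q q').trans_lt (lt_tsub_iff_left.1 hq')

theorem isOpen_lt_dist [NeZero N] (hS : S.Assumptions aMin AMax σMin θMin) (p : E N) (c : ℝ≥0∞) :
    IsOpen {q ∈ S.M | c < S.dist p q} := by
  rw [isOpen_iff_eventually]
  rintro q ⟨hqM, hq⟩
  filter_upwards [S.isOpen_M.mem_nhds hqM, hS.eventually_dist_lt hqM (tsub_pos_of_lt hq)]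
    with q' hq'M hq'
  refine ⟨hq'M, ?_⟩
  by_contra! hle
  refine (lt_tsub_iff_left.1 hq').not_ge ((dist_triangle p q' q).trans ?_)
  rw [dist_comm q' q]
  gcongr

/-- Connectedness forbids `dist p` to jump over the interval `(c, σ)` on `K`. -/
theorem dist_le_of_isPreconnected [NeZero N] (hS : S.Assumptions aMin AMax σMin θMin)
    {p : E N} {c : ℝ} {σ : ℝ≥0∞} (hp : p ∈ S.M) (hc : 0 ≤ c) (hσ : ENNReal.ofReal c < σ)
    (hball : Metric.closedBall p c ⊆ S.M) {K : Set (E N)} (hK : IsPreconnected K) (hpK : p ∈ K)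
    (hgap : ∀ q ∈ K, S.dist p q < σ → S.dist p q ≤ ENNReal.ofReal c) {q : E N} (hq : q ∈ K) :
    S.dist p q ≤ ENNReal.ofReal c := by
  set far := (Metric.closedBall p c)ᶜ ∪ {q ∈ S.M | ENNReal.ofReal c < S.dist p q}
  have hfar : ∀ q, q ∉ far ↔ q ∈ Metric.closedBall p c ∧ S.dist p q ≤ ENNReal.ofReal c :=
    fun q => by
      simp only [far, mem_union, mem_compl_iff, mem_ofPred_eq, not_or, not_not, not_and, not_lt]
      exact and_congr_right fun h => imp_iff_right (hball h)
  have hnear : ∀ q, S.dist p q ≤ ENNReal.ofReal c → q ∉ far := fun q hq => by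
    refine (hfar q).2 ⟨?_, hq⟩
    rw [Metric.mem_closedBall, dist_eq_norm, norm_sub_rev]
    exact (ENNReal.ofReal_le_ofReal_iff hc).1 ((norm_sub_le_dist p q).trans hq)
  by_contra hcon
  obtain ⟨q', hq'K, hq'σ, hq'far⟩ := hK {q | S.dist p q < σ} far (hS.isOpen_dist_lt p σ)
    (Metric.isClosed_closedBall.isOpen_compl.union (hS.isOpen_lt_dist p _))
    (fun q _ => or_iff_not_imp_right.2 fun hq => ((hfar q).1 hq).2.trans_lt hσ)
    ⟨p, hpK, by simpa [dist_self hp] using pos_of_gt hσ⟩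
    ⟨q, hq, by by_contra h; exact hcon ((hfar q).1 h).2⟩
  exact hnear q' (hgap q' hq'K hq'σ) hq'far

theorem exists_box [NeZero N] (hS : S.Assumptions aMin AMax σMin θMin) {p : E N} (hp : p ∈ S.M)
    {ρ : ℝ} (hρ : 0 ≤ ρ) (hσ : AMax * ρ < σMin) (hball : Metric.closedBall p (AMax * ρ) ⊆ S.M) :
    ∃ Q : Set (E N), MeasurableSet Q ∧
      volume Q = ENNReal.ofReal (2 ^ N * ρ ^ S.homDim p) ∧
      ∀ q ∈ Q, S.dist p q ≤ ENNReal.ofReal (AMax * ρ) := by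
  obtain ⟨z, hz, hballBox⟩ := hS.ballBox p hp
  obtain ⟨Φ, hΦ, hmp⟩ := hz.exists_homeomorph
  have hpre : IsPreconnected (Φ ⁻¹' box (S.weight p) ρ) := by
    rw [← Φ.image_symm]
    exact (convex_Icc _ _).isPreconnected.image _ Φ.symm.continuous.continuousOn
  refine ⟨Φ ⁻¹' box (S.weight p) ρ, Φ.continuous.measurable (measurableSet_box _ _), ?_, fun q hq =>
    hS.dist_le_of_isPreconnected hp (mul_nonneg hS.AMax_pos.le hρ)
      ((ENNReal.ofReal_lt_ofReal_iff hS.σMin_pos).2 hσ) hball hpre ?_ (fun q hq hd => ?_) hq⟩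
  · rw [hmp.measure_preimage (measurableSet_box _ _).nullMeasurableSet, volume_box _ hρ,
      Fintype.card_fin, homDim]
  · rw [mem_preimage, hΦ, hz.apply_self]
    exact zero_mem_box _ hρ
  · refine (hballBox q (mem_of_dist_ne_top hd.ne_top).2 hd).2.trans (ENNReal.ofReal_le_ofReal ?_)
    exact mul_le_mul_of_nonneg_left (pseudonorm_le_of_mem_box
      (weight_pos hS.bracketGenerating hp) hρ (hΦ q ▸ hq)) hS.AMax_pos.le

end Assumptions

end System

/-! ### Separated subfamilies of chains -/

section Separated

/-- `i` is a record, with margin `c`, of the sequence `f` started at `a`: the value `f i` exceeds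
each of `f a, …, f (i - 1)` by at least `c`. -/
def IsRecord (f : ℕ → ℝ) (c : ℝ) (a i : ℕ) : Prop := ∀ j ∈ Finset.Ico a i, f j + c ≤ f i

open scoped Classical in
theorem add_mul_card_filter_not_isRecord_le {f : ℕ → ℝ} {c : ℝ} (hc : 0 ≤ c)
    (hf : ∀ i, f (i + 1) ≤ f i + 2 * c) {a b : ℕ} (hab : a ≤ b) :
    ∀ j ∈ Finset.Icc a b, f j + c * ((Finset.Ioc a b).filter fun i => ¬IsRecord f c a i).card ≤
      f a + 2 * c * ((b : ℝ) - a) := by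
  induction b, hab using Nat.le_induction with
  | base => simp
  | succ b hab ih =>
    intro j hj
    rw [← Finset.insert_Icc_right_eq_Icc_add_one (by omega), Finset.mem_insert] at hj
    rw [← Finset.insert_Ioc_right_eq_Ioc_add_one hab, Finset.filter_insert]
    have hfb := ih b (Finset.right_mem_Icc.2 hab)
    split_ifs with hrec
    · rcases hj with rfl | hj
      · push_cast
        linarith [hf b]
      · push_cast
        linarith [ih j hj]
    · rw [Finset.card_insert_of_notMem (by simp)]
      simp only [IsRecord, not_forall, not_le] at hrec
      obtain ⟨i, hi, hlt⟩ := hrec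
      have hfi := ih i (by simp only [Finset.mem_Ico, Finset.mem_Icc] at hi ⊢; omega)
      push_cast
      rcases hj with rfl | hj
      · linarith
      · linarith [ih j hj]

variable {X : Type*} [PseudoMetricSpace X] {p : ℕ → X} {h : ℝ}

theorem exists_separated (hh : 0 ≤ h) (hp : ∀ i, dist (p i) (p (i + 1)) ≤ h) {a b : ℕ}
    (hab : a ≤ b) :
    ∃ G ⊆ Finset.Ioc a b, (G : Set ℕ).Pairwise (fun i j => h / 2 ≤ dist (p i) (p j)) ∧
      h / 2 * (Finset.Ioc a b \ G).card ≤ h * ((b : ℝ) - a) - dist (p a) (p b) := by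
  classical
  set f : ℕ → ℝ := fun i => dist (p a) (p i)
  refine ⟨(Finset.Ioc a b).filter (IsRecord f (h / 2) a), Finset.filter_subset _ _, ?_, ?_⟩
  · have hrecord : ∀ i j, a < i → i < j → IsRecord f (h / 2) a j → h / 2 ≤ dist (p i) (p j) := by
      intro i j hai hij hj
      linarith [hj i (Finset.mem_Ico.2 ⟨hai.le, hij⟩), dist_triangle (p a) (p i) (p j)]
    intro i hi j hj hij
    simp only [Finset.coe_filter, Finset.mem_Ioc, mem_ofPred_eq] at hi hj
    rcases hij.lt_or_gt with hlt | hlt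
    · exact hrecord i j hi.1.1 hlt hj.2
    · exact dist_comm (p i) (p j) ▸ hrecord j i hj.1.1 hlt hi.2
  · have hf : ∀ i, f (i + 1) ≤ f i + 2 * (h / 2) := fun i => by
      linarith [dist_triangle (p a) (p i) (p (i + 1)), hp i]
    have hcount := add_mul_card_filter_not_isRecord_le (by positivity) hf hab b
      (Finset.right_mem_Icc.2 hab)
    have hfa : f a = 0 := dist_self (p a)
    rw [← Finset.filter_not]
    linarith

theorem card_Ioc_sdiff_biUnion_le (a : ℕ → ℕ) (M : ℕ) (G : ℕ → Finset ℕ) (P : ℕ) :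
    (Finset.Ioc 0 M \ (Finset.range P).biUnion G).card ≤
      a 0 + ∑ j ∈ Finset.range P, (Finset.Ioc (a j) (a (j + 1)) \ G j).card + (M - a P) := by
  have hcover : Finset.Ioc 0 M \ (Finset.range P).biUnion G ⊆
      (Finset.Ioc 0 (a P) \ (Finset.range P).biUnion G) ∪ Finset.Ioc (a P) M := by
    intro i
    simp only [Finset.mem_union, Finset.mem_sdiff, Finset.mem_Ioc]
    grind
  have hcard : ∀ P, (Finset.Ioc 0 (a P) \ (Finset.range P).biUnion G).card ≤
      a 0 + ∑ j ∈ Finset.range P, (Finset.Ioc (a j) (a (j + 1)) \ G j).card := by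
    intro P
    induction P with
    | zero => simp
    | succ P ih =>
      have hcover : Finset.Ioc 0 (a (P + 1)) \ (Finset.range (P + 1)).biUnion G ⊆
          (Finset.Ioc 0 (a P) \ (Finset.range P).biUnion G) ∪
            (Finset.Ioc (a P) (a (P + 1)) \ G P) := by
        intro i
        simp only [Finset.range_add_one, Finset.biUnion_insert, Finset.mem_union,
          Finset.mem_sdiff, Finset.mem_Ioc, not_or]
        grind
      rw [Finset.sum_range_succ, ← add_assoc]
      exact (Finset.card_le_card hcover).trans ((Finset.card_union_le _ _).trans (by gcongr))
  calc _ ≤ _ := (Finset.card_le_card hcover).trans (Finset.card_union_le _ _)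
    _ ≤ _ := by rw [Nat.card_Ioc]; gcongr; exact hcard P

theorem exists_separated_pieces (hh : 0 ≤ h) (hp : ∀ i, dist (p i) (p (i + 1)) ≤ h)
    {a : ℕ → ℕ} (ha : Monotone a) {M : ℕ} (haM : ∀ j, a j ≤ M) (P : ℕ) :
    ∃ G : ℕ → Finset ℕ, (∀ j, G j ⊆ Finset.Ioc 0 M) ∧
      (∀ j, (G j : Set ℕ).Pairwise fun i i' => h / 2 ≤ dist (p i) (p i')) ∧
      h / 2 * (Finset.Ioc 0 M \ (Finset.range P).biUnion G).card ≤
        h * M - ∑ j ∈ Finset.range P, dist (p (a j)) (p (a (j + 1))) := by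
  choose G hGsub hGsep hGcard using fun j => exists_separated hh hp (ha (Nat.le_succ j))
  refine ⟨G, fun j => (hGsub j).trans (Finset.Ioc_subset_Ioc (Nat.zero_le _) (haM _)), hGsep, ?_⟩
  have hcard : ((Finset.Ioc 0 M \ (Finset.range P).biUnion G).card : ℝ) ≤
      a 0 + ∑ j ∈ Finset.range P, ((Finset.Ioc (a j) (a (j + 1)) \ G j).card : ℝ) + (M - a P) := by
    rw [← Nat.cast_sub (haM P)]
    exact_mod_cast card_Ioc_sdiff_biUnion_le a M G P
  have hsum := Finset.sum_le_sum fun j (_ : j ∈ Finset.range P) => hGcard j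
  rw [← Finset.mul_sum, Finset.sum_sub_distrib, ← Finset.mul_sum,
    Finset.sum_range_sub fun j => (a j : ℝ)] at hsum
  have haP : (a P : ℝ) ≤ M := by exact_mod_cast haM P
  nlinarith [(a 0).cast_nonneg (α := ℝ)]

end Separated

namespace System

variable {N m : ℕ} {S : System N m} {x : ℝ → E N} {T : ℝ}

/-! ### Equipartitions of a trajectory -/

/-- The length of `x` up to time `t`, as a real number. -/
def lengthTo (x : ℝ → E N) (t : ℝ) : ℝ := (arcLength x 0 t).toReal

theorem lengthTo_nonneg (x : ℝ → E N) (t : ℝ) : 0 ≤ lengthTo x t := ENNReal.toReal_nonneg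

theorem lengthTo_zero (x : ℝ → E N) : lengthTo x 0 = 0 := by
  rw [lengthTo, arcLength_self, ENNReal.toReal_zero]

theorem HasVelocity.lengthTo_eq {f : ℝ → E N} (h : HasVelocity x f T) {t : ℝ}
    (ht : t ∈ Icc 0 T) : lengthTo x t = ∫ s in (0 : ℝ)..t, ‖f s‖ := by
  rw [lengthTo, h.arcLength_eq_ofReal le_rfl ht.1 ht.2, ENNReal.toReal_ofReal
    (intervalIntegral.integral_nonneg ht.1 fun _ _ => norm_nonneg _)]

theorem HasVelocity.lengthTo_sub_eq {f : ℝ → E N} (h : HasVelocity x f T) {a b : ℝ}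
    (ha : a ∈ Icc 0 T) (hb : b ∈ Icc 0 T) :
    lengthTo x b - lengthTo x a = ∫ s in a..b, ‖f s‖ := by
  have h0 : (0 : ℝ) ∈ Icc 0 T := left_mem_Icc.2 h.nonneg
  rw [h.lengthTo_eq ha, h.lengthTo_eq hb]
  exact intervalIntegral.integral_interval_sub_left (h.mono_intervalIntegrable h0 hb).norm
    (h.mono_intervalIntegrable h0 ha).norm

theorem IsTrajectory.arcLength_eq_ofReal_lengthTo_sub (hx : S.IsTrajectory x T) {a b : ℝ}
    (ha : 0 ≤ a) (hab : a ≤ b) (hb : b ≤ T) :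
    arcLength x a b = ENNReal.ofReal (lengthTo x b - lengthTo x a) := by
  obtain ⟨u, -, -, h⟩ := hx.exists_control
  rw [h.arcLength_eq_ofReal ha hab hb, h.lengthTo_sub_eq ⟨ha, hab.trans hb⟩ ⟨ha.trans hab, hb⟩]

theorem IsTrajectory.arcLength_eq_ofReal_lengthTo (hx : S.IsTrajectory x T) :
    arcLength x 0 T = ENNReal.ofReal (lengthTo x T) := by
  rw [hx.arcLength_eq_ofReal_lengthTo_sub le_rfl hx.1 le_rfl, lengthTo_zero, sub_zero]

theorem IsTrajectory.monotoneOn_lengthTo (hx : S.IsTrajectory x T) :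
    MonotoneOn (lengthTo x) (Icc 0 T) := by
  obtain ⟨u, -, -, h⟩ := hx.exists_control
  intro a ha b hb hab
  rw [← sub_nonneg, h.lengthTo_sub_eq ha hb]
  exact intervalIntegral.integral_nonneg hab fun _ _ => norm_nonneg _

theorem IsTrajectory.continuousOn_lengthTo (hx : S.IsTrajectory x T) :
    ContinuousOn (lengthTo x) (Icc 0 T) := by
  obtain ⟨u, -, -, h⟩ := hx.exists_control
  have hint : IntegrableOn (fun s => ‖S.velocity u x s‖) (uIcc 0 T) := by
    rw [uIcc_of_le hx.1]
    exact (intervalIntegrable_iff_integrableOn_Icc_of_le hx.1).1 h.intervalIntegrable.norm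
  have hcont := intervalIntegral.continuousOn_primitive_interval hint
  rw [uIcc_of_le hx.1] at hcont
  exact hcont.congr fun t ht => h.lengthTo_eq ht

theorem IsTrajectory.dist_le_ofReal_abs (hx : S.IsTrajectory x T) {s t : ℝ} (hs : s ∈ Icc 0 T)
    (ht : t ∈ Icc 0 T) :
    S.dist (x s) (x t) ≤ ENNReal.ofReal |lengthTo x s - lengthTo x t| := by
  wlog hst : s ≤ t generalizing s t
  · rw [dist_comm, abs_sub_comm]
    exact this ht hs (le_of_not_ge hst)
  rw [abs_sub_comm]
  calc S.dist (x s) (x t) ≤ arcLength x s t := hx.dist_le_arcLength hs.1 hst ht.2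
    _ = ENNReal.ofReal (lengthTo x t - lengthTo x s) :=
      hx.arcLength_eq_ofReal_lengthTo_sub hs.1 hst ht.2
    _ ≤ _ := ENNReal.ofReal_le_ofReal (le_abs_self _)

theorem IsTrajectory.norm_sub_le (hx : S.IsTrajectory x T) {s t : ℝ} (hs : s ∈ Icc 0 T)
    (ht : t ∈ Icc 0 T) : ‖x s - x t‖ ≤ |lengthTo x s - lengthTo x t| :=
  (ENNReal.ofReal_le_ofReal_iff (abs_nonneg _)).1
    ((norm_sub_le_dist _ _).trans (hx.dist_le_ofReal_abs hs ht))

theorem IsTrajectory.exists_chord_sum (hx : S.IsTrajectory x T) {e : ℝ} (he : 0 < e) :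
    ∃ (P : ℕ) (u : ℕ → ℝ), Monotone u ∧ (∀ i, u i ∈ Icc 0 T) ∧
      lengthTo x T - e ≤ ∑ j ∈ Finset.range P, ‖x (u j) - x (u (j + 1))‖ := by
  rcases le_or_gt (lengthTo x T) 0 with hL | hL
  · exact ⟨0, fun _ => 0, monotone_const, fun _ => left_mem_Icc.2 hx.1, by simp; linarith⟩
  have hlt : ENNReal.ofReal (lengthTo x T - e) < eVariationOn x (Icc 0 T) :=
    calc ENNReal.ofReal (lengthTo x T - e) < ENNReal.ofReal (lengthTo x T) :=
          (ENNReal.ofReal_lt_ofReal_iff hL).2 (sub_lt_self _ he)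
      _ = arcLength x 0 T := hx.arcLength_eq_ofReal_lengthTo.symm
      _ ≤ _ := lintegral_enorm_deriv_le_eVariationOn x hx.1
  obtain ⟨⟨P, u, hu, hmem⟩, hsum⟩ := lt_iSup_iff.1 hlt
  refine ⟨P, u, hu, hmem, ?_⟩
  simp only [edist_dist] at hsum
  rw [← ENNReal.ofReal_sum_of_nonneg fun _ _ => dist_nonneg] at hsum
  simpa only [dist_eq_norm, norm_sub_rev] using (ENNReal.ofReal_lt_ofReal_iff'.1 hsum).1.le

/-- The times `t 0 ≤ … ≤ t M` cut the trajectory `x` on `[0,T]` into `M` pieces of equal length `h`.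
From index `M + 1` on all times are `T`; time `t M`, where the whole length is first attained in
the partition, may be smaller. The case `M = 0` is that of a trajectory of length zero. -/
structure IsEquipartition (x : ℝ → E N) (T : ℝ) (M : ℕ) (h : ℝ) (t : ℕ → ℝ) : Prop where
  step_pos : 0 < h
  mul_step : M * h = lengthTo x T
  monotone : Monotone t
  zero : t 0 = 0
  eq_of_lt : ∀ i, M < i → t i = T
  lengthTo_eq : ∀ i ≤ M, lengthTo x (t i) = i * h

theorem IsTrajectory.exists_isEquipartition (hx : S.IsTrajectory x T) {M : ℕ} {h : ℝ}
    (hh : 0 < h) (hM : M * h = lengthTo x T) : ∃ t, IsEquipartition x T M h t := by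
  have hivt : ∀ i : ℕ, ∃ s ∈ Icc 0 T, i ≤ M → lengthTo x s = i * h := by
    intro i
    rcases le_or_gt i M with hi | hi
    · have hmem : i * h ∈ Icc (lengthTo x 0) (lengthTo x T) := by
        rw [lengthTo_zero, ← hM]
        exact ⟨by positivity, by gcongr⟩
      obtain ⟨s, hs, hsi⟩ := intermediate_value_Icc hx.1 hx.continuousOn_lengthTo hmem
      exact ⟨s, hs, fun _ => hsi⟩
    · exact ⟨0, left_mem_Icc.2 hx.1, fun hle => absurd hle hi.not_ge⟩
  choose s hs hlen using hivt
  refine ⟨fun i => if i = 0 then 0 else if i ≤ M then s i else T, hh, hM,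
    monotone_nat_of_le_succ fun i => ?_, if_pos rfl, fun i hi => ?_, fun i hi => ?_⟩
  · rcases i.eq_zero_or_pos with rfl | hi0
    · simp only [if_true, zero_add, one_ne_zero, if_false]
      split_ifs
      exacts [(hs 1).1, hx.1]
    · simp only [hi0.ne', i.succ_ne_zero, if_false]
      split_ifs with hi hi' hi'
      · refine (hx.monotoneOn_lengthTo.reflect_lt (hs i) (hs (i + 1)) ?_).le
        rw [hlen i hi, hlen (i + 1) hi']
        push_cast
        linarith
      · exact (hs i).2
      · omega
      · exact le_rfl
  · simp only [(Nat.zero_le M).trans_lt hi |>.ne', hi.not_ge, if_false]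
  · rcases i.eq_zero_or_pos with rfl | hi0
    · simp [lengthTo_zero]
    · simp only [hi0.ne', hi, if_true, if_false, hlen i hi]

namespace IsEquipartition

variable {M : ℕ} {h : ℝ} {t : ℕ → ℝ}

theorem mem (ht : IsEquipartition x T M h t) (i : ℕ) : t i ∈ Icc 0 T :=
  ⟨ht.zero ▸ ht.monotone i.zero_le,
    ht.eq_of_lt _ (show M < i + (M + 1) by omega) ▸ ht.monotone (Nat.le_add_right _ _)⟩

theorem abs_lengthTo_sub_le (ht : IsEquipartition x T M h t) (hx : S.IsTrajectory x T) {i : ℕ}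
    {s : ℝ} (hs : s ∈ Icc (t i) (t (i + 1))) : |lengthTo x (t i) - lengthTo x s| ≤ h := by
  have hsT : s ∈ Icc 0 T := ⟨(ht.mem i).1.trans hs.1, hs.2.trans (ht.mem _).2⟩
  have hle := hx.monotoneOn_lengthTo (ht.mem i) hsT hs.1
  rw [abs_sub_comm, abs_of_nonneg (sub_nonneg.2 hle)]
  rcases lt_or_ge i M with hi | hi
  · have hnext := hx.monotoneOn_lengthTo hsT (ht.mem (i + 1)) hs.2
    rw [ht.lengthTo_eq _ hi] at hnext
    rw [ht.lengthTo_eq i hi.le]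
    push_cast at hnext
    linarith
  · have hlast := hx.monotoneOn_lengthTo hsT (right_mem_Icc.2 hx.1) hsT.2
    have hM := hx.monotoneOn_lengthTo (ht.mem M) (ht.mem i) (ht.monotone hi)
    rw [ht.lengthTo_eq M le_rfl, ht.mul_step] at hM
    linarith [ht.step_pos]

theorem dist_le (ht : IsEquipartition x T M h t) (hx : S.IsTrajectory x T) {i : ℕ}
    {s : ℝ} (hs : s ∈ Icc (t i) (t (i + 1))) : S.dist (x (t i)) (x s) ≤ ENNReal.ofReal h :=
  (hx.dist_le_ofReal_abs (ht.mem i) ⟨(ht.mem i).1.trans hs.1, hs.2.trans (ht.mem _).2⟩).trans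
    (ENNReal.ofReal_le_ofReal (ht.abs_lengthTo_sub_le hx hs))

theorem dist_succ_le (ht : IsEquipartition x T M h t) (hx : S.IsTrajectory x T) (i : ℕ) :
    S.dist (x (t i)) (x (t (i + 1))) ≤ ENNReal.ofReal h :=
  ht.dist_le hx (right_mem_Icc.2 (ht.monotone i.le_succ))

theorem floor_le (ht : IsEquipartition x T M h t) (hx : S.IsTrajectory x T) {s : ℝ}
    (hs : s ∈ Icc 0 T) : ⌊lengthTo x s / h⌋₊ ≤ M := by
  refine Nat.floor_le_of_le ((div_le_iff₀ ht.step_pos).2 ?_)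
  rw [ht.mul_step]
  exact hx.monotoneOn_lengthTo hs (right_mem_Icc.2 hx.1) hs.2

theorem norm_floor_sub_le (ht : IsEquipartition x T M h t) (hx : S.IsTrajectory x T) {s : ℝ}
    (hs : s ∈ Icc 0 T) : ‖x (t ⌊lengthTo x s / h⌋₊) - x s‖ ≤ h := by
  refine (hx.norm_sub_le (ht.mem _) hs).trans ?_
  have hle := Nat.floor_le (div_nonneg (lengthTo_nonneg x s) ht.step_pos.le)
  have hlt := Nat.lt_floor_add_one (lengthTo x s / h)
  rw [le_div_iff₀ ht.step_pos] at hle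
  rw [div_lt_iff₀ ht.step_pos] at hlt
  rw [ht.lengthTo_eq _ (ht.floor_le hx hs), abs_le]
  constructor <;> linarith [ht.step_pos]

end IsEquipartition

theorem IsTrajectory.exists_separated_families (hx : S.IsTrajectory x T) {e : ℝ} (he : 0 < e) :
    ∃ P : ℕ, ∀ M h t, IsEquipartition x T M h t → ∃ G : ℕ → Finset ℕ,
      (∀ j, G j ⊆ Finset.Ioc 0 M) ∧
      (∀ j, (G j : Set ℕ).Pairwise fun i i' => h / 2 ≤ ‖x (t i) - x (t i')‖) ∧
      h / 2 * (Finset.Ioc 0 M \ (Finset.range P).biUnion G).card ≤ e + 2 * P * h := by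
  obtain ⟨P, u, hu, humem, hsum⟩ := hx.exists_chord_sum he
  refine ⟨P, fun M h t ht => ?_⟩
  set a : ℕ → ℕ := fun j => ⌊lengthTo x (u j) / h⌋₊
  have ha : Monotone a := fun i j hij => Nat.floor_mono <|
    div_le_div_of_nonneg_right (hx.monotoneOn_lengthTo (humem i) (humem j) (hu hij)) ht.step_pos.le
  have hstep : ∀ i, Dist.dist (x (t i)) (x (t (i + 1))) ≤ h := fun i => by
    rw [dist_eq_norm]
    exact (hx.norm_sub_le (ht.mem i) (ht.mem _)).trans
      (ht.abs_lengthTo_sub_le hx (right_mem_Icc.2 (ht.monotone i.le_succ)))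
  obtain ⟨G, hGsub, hGsep, hGcard⟩ := exists_separated_pieces (p := fun i => x (t i))
    ht.step_pos.le hstep ha (fun j => ht.floor_le hx (humem j)) P
  simp only [dist_eq_norm] at hGsep hGcard
  refine ⟨G, hGsub, hGsep, hGcard.trans ?_⟩
  have hchord : ∑ j ∈ Finset.range P, (‖x (u j) - x (u (j + 1))‖ - 2 * h) ≤
      ∑ j ∈ Finset.range P, ‖x (t (a j)) - x (t (a (j + 1)))‖ := by
    refine Finset.sum_le_sum fun j _ => ?_
    have h₁ := ht.norm_floor_sub_le hx (humem j)
    have h₂ := ht.norm_floor_sub_le hx (humem (j + 1))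
    have := norm_sub_le_norm_sub_add_norm_sub (x (u j)) (x (t (a j))) (x (u (j + 1)))
    have := norm_sub_le_norm_sub_add_norm_sub (x (t (a j))) (x (t (a (j + 1)))) (x (u (j + 1)))
    rw [norm_sub_rev] at h₁
    linarith
  rw [Finset.sum_sub_distrib, Finset.sum_const, Finset.card_range, nsmul_eq_mul] at hchord
  linarith [ht.mul_step]

/-! ### Tracing by waypoints close to an equipartition -/

theorem exists_mem_Icc_castSucc_succ {α : Type*} [LinearOrder α] {k : ℕ} (τ : Fin (k + 2) → α)
    {s : α} (h0 : τ 0 ≤ s) (h1 : s ≤ τ (Fin.last (k + 1))) :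
    ∃ j : Fin (k + 1), s ∈ Icc (τ j.castSucc) (τ j.succ) := by
  induction k with
  | zero => exact ⟨0, h0, h1⟩
  | succ k ih =>
    rcases le_total (τ (Fin.last (k + 1)).castSucc) s with h | h
    · exact ⟨Fin.last (k + 1), h, h1⟩
    · obtain ⟨j, hj⟩ := ih (fun j => τ j.castSucc) h0 h
      exact ⟨j.castSucc, hj⟩

theorem IsTrajectory.dist_le_or_dist_le (hx : S.IsTrajectory x T) {a b s c : ℝ} (hc : 0 ≤ c)
    (ha : a ∈ Icc 0 T) (hb : b ∈ Icc 0 T) (hs : s ∈ Icc a b)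
    (h : arcLength x a b ≤ ENNReal.ofReal (2 * c)) :
    S.dist (x s) (x a) ≤ ENNReal.ofReal c ∨ S.dist (x s) (x b) ≤ ENNReal.ofReal c := by
  have hsT : s ∈ Icc 0 T := ⟨ha.1.trans hs.1, hs.2.trans hb.2⟩
  rw [hx.arcLength_eq_ofReal_lengthTo_sub ha.1 (hs.1.trans hs.2) hb.2,
    ENNReal.ofReal_le_ofReal_iff (by positivity)] at h
  have has := hx.monotoneOn_lengthTo ha hsT hs.1
  have hsb := hx.monotoneOn_lengthTo hsT hb hs.2
  refine (le_total (lengthTo x s - lengthTo x a) c).imp (fun hle => ?_) fun hle => ?_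
  · refine (hx.dist_le_ofReal_abs hsT ha).trans (ENNReal.ofReal_le_ofReal ?_)
    rwa [abs_of_nonneg (sub_nonneg.2 has)]
  · refine (hx.dist_le_ofReal_abs hsT hb).trans (ENNReal.ofReal_le_ofReal ?_)
    rw [abs_sub_comm, abs_of_nonneg (sub_nonneg.2 hsb)]
    linarith

namespace IsConnection

variable {κ : ℝ≥0} {k : ℕ} {y : Fin (k + 1) → E N} {Y : ℝ → E N} {R : ℝ}

theorem arcLength_le (hY : S.IsConnection κ y Y R) :
    arcLength Y 0 R ≤ ∑ j : Fin k, (S.dist (y j.castSucc) (y j.succ) + κ) := by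
  obtain ⟨-, τ, hτ, h0, rfl, -, hlen⟩ := hY
  exact h0 ▸ (arcLength_le_sum Y τ hτ).trans (Finset.sum_le_sum fun j _ => hlen j)

theorem exists_dist_waypoint_le (hY : S.IsConnection κ y Y R) {c : ℝ} (hc : 0 ≤ c)
    (hgap : ∀ j : Fin k, S.dist (y j.castSucc) (y j.succ) + κ ≤ ENNReal.ofReal (2 * c)) {s : ℝ}
    (hs : s ∈ Icc 0 R) : ∃ i, S.dist (Y s) (y i) ≤ ENNReal.ofReal c := by
  obtain ⟨htraj, τ, hτ, h0, hR, hval, hlen⟩ := hY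
  have hmem : ∀ i, τ i ∈ Icc 0 R := fun i => ⟨h0 ▸ hτ (Fin.zero_le i), hR ▸ hτ (Fin.le_last i)⟩
  cases k with
  | zero =>
    obtain rfl : R = 0 := by rw [← hR, ← h0, Fin.last_zero]
    obtain rfl : s = 0 := le_antisymm hs.2 hs.1
    refine ⟨0, ?_⟩
    rw [← hval, h0, dist_self (htraj.2.2.1 _ hs)]
    exact zero_le
  | succ k =>
    obtain ⟨j, hj⟩ := exists_mem_Icc_castSucc_succ τ (h0 ▸ hs.1) (hR ▸ hs.2)
    simp only [← hval] at hgap ⊢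
    rcases htraj.dist_le_or_dist_le hc (hmem _) (hmem _) hj
      ((hlen j).trans (by simpa only [hval] using hgap j)) with h | h
    exacts [⟨_, h⟩, ⟨_, h⟩]

end IsConnection

namespace IsEquipartition

variable {M : ℕ} {h : ℝ} {t : ℕ → ℝ} {r ε : ℝ} {err : ℕ → ℝ} {y : Fin (M + 1) → E N}

theorem dist_waypoint_succ_le (ht : IsEquipartition x T M h t) (hx : S.IsTrajectory x T)
    (herr0 : ∀ i, 0 ≤ err i)
    (hy : ∀ i : Fin (M + 1), S.dist (x (t i)) (y i) ≤ ENNReal.ofReal (err i)) (j : Fin M) :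
    S.dist (y j.castSucc) (y j.succ) ≤ ENNReal.ofReal (err j + h + err (j + 1)) := by
  have hh := ht.step_pos.le
  calc S.dist (y j.castSucc) (y j.succ)
      ≤ S.dist (y j.castSucc) (x (t j)) + S.dist (x (t j)) (x (t (j + 1))) +
          S.dist (x (t (j + 1))) (y j.succ) :=
        (dist_triangle _ (x (t (j + 1))) _).trans (by gcongr; exact dist_triangle _ _ _)
    _ ≤ ENNReal.ofReal (err j) + ENNReal.ofReal h + ENNReal.ofReal (err (j + 1)) := by
        gcongr
        · exact dist_comm (S := S) _ _ ▸ hy j.castSucc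
        · exact ht.dist_succ_le hx j
        · exact hy j.succ
    _ = _ := by
        rw [ENNReal.ofReal_add (add_nonneg (herr0 _) hh) (herr0 _), ENNReal.ofReal_add (herr0 _) hh]

theorem dist_waypoint_le (ht : IsEquipartition x T M h t) (hx : S.IsTrajectory x T)
    (herr0 : ∀ i, 0 ≤ err i)
    (hy : ∀ i : Fin (M + 1), S.dist (x (t i)) (y i) ≤ ENNReal.ofReal (err i)) (j : Fin (M + 1))
    {s : ℝ} (hs : s ∈ Icc (t j) (t (j + 1))) :
    S.dist (y j) (x s) ≤ ENNReal.ofReal (err j + h) := by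
  rw [ENNReal.ofReal_add (herr0 _) ht.step_pos.le]
  exact (dist_triangle _ (x (t j)) _).trans
    (add_le_add (dist_comm (S := S) _ _ ▸ hy j) (ht.dist_le hx hs))

theorem arcLength_connection_le (ht : IsEquipartition x T M h t) (hx : S.IsTrajectory x T)
    (herr0 : ∀ i, 0 ≤ err i)
    (hy : ∀ i : Fin (M + 1), S.dist (x (t i)) (y i) ≤ ENNReal.ofReal (err i)) {κ : ℝ≥0}
    (hsum : ∑ j ∈ Finset.range M, (err j + err (j + 1) + κ) ≤ ε * lengthTo x T) {Y : ℝ → E N}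
    {R : ℝ} (hY : S.IsConnection κ y Y R) :
    arcLength Y 0 R ≤ ENNReal.ofReal (1 + ε) * arcLength x 0 T := by
  have hnonneg : ∀ j, 0 ≤ err j + h + err (j + 1) := fun j => by
    linarith [herr0 j, herr0 (j + 1), ht.step_pos]
  calc arcLength Y 0 R ≤ ∑ j : Fin M, (S.dist (y j.castSucc) (y j.succ) + κ) := hY.arcLength_le
    _ ≤ ∑ j : Fin M, ENNReal.ofReal (err j + h + err (j + 1) + κ) := by
        gcongr with j
        rw [ENNReal.ofReal_add (hnonneg j) κ.coe_nonneg, ENNReal.ofReal_coe_nnreal]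
        gcongr
        exact ht.dist_waypoint_succ_le hx herr0 hy j
    _ = ENNReal.ofReal (∑ j ∈ Finset.range M, (err j + err (j + 1) + κ) + M * h) := by
        rw [Fin.sum_univ_eq_sum_range fun j => ENNReal.ofReal (err j + h + err (j + 1) + κ),
          ← ENNReal.ofReal_sum_of_nonneg fun j _ => add_nonneg (hnonneg j) κ.coe_nonneg]
        simp only [Finset.sum_add_distrib, Finset.sum_const, Finset.card_range, nsmul_eq_mul]
        ring_nf
    _ ≤ ENNReal.ofReal ((1 + ε) * lengthTo x T) := by
        refine ENNReal.ofReal_le_ofReal ?_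
        linarith [ht.mul_step]
    _ = _ := by
        rw [ENNReal.ofReal_mul' (lengthTo_nonneg x T), hx.arcLength_eq_ofReal_lengthTo]

theorem traces (ht : IsEquipartition x T M h t) (hx : S.IsTrajectory x T) (hh : h ≤ r / 2)
    (herr0 : ∀ i, 0 ≤ err i) (herr : ∀ i, err i ≤ r / 4)
    (hy : ∀ i : Fin (M + 1), S.dist (x (t i)) (y i) ≤ ENNReal.ofReal (err i)) {κ : ℝ≥0}
    (hκ : 0 < κ) (hκr : κ ≤ r / 2)
    (hsum : ∑ j ∈ Finset.range M, (err j + err (j + 1) + κ) ≤ ε * lengthTo x T) :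
    S.Traces x T ε r y := by
  have hr : 0 ≤ r := by linarith [ht.step_pos]
  have hgap := ht.dist_waypoint_succ_le hx herr0 hy
  have hgapr : ∀ j : Fin M, S.dist (y j.castSucc) (y j.succ) ≤ ENNReal.ofReal r := fun j =>
    (hgap j).trans (ENNReal.ofReal_le_ofReal (by linarith [herr j, herr (j + 1)]))
  have hgapκ : ∀ j : Fin M, S.dist (y j.castSucc) (y j.succ) + κ ≤
      ENNReal.ofReal (2 * (3 * r / 4)) := fun j => by
    rw [← ENNReal.ofReal_coe_nnreal]
    refine (add_le_add_left (hgap j) _).trans ?_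
    rw [← ENNReal.ofReal_add (by linarith [herr0 j, herr0 (j + 1), ht.step_pos]) κ.coe_nonneg]
    exact ENNReal.ofReal_le_ofReal (by linarith [herr j, herr (j + 1)])
  refine ⟨hgapr, fun κ hκ => exists_isConnection hκ y ?_ fun j =>
    ((hgapr j).trans_lt ENNReal.ofReal_lt_top).ne, ⟨κ, hκ, fun Y R hY =>
    ⟨ht.arcLength_connection_le hx herr0 hy hsum hY, fun s hs => ?_⟩⟩,
    fun j => t j, fun i j hij => ht.monotone hij, ht.zero, ht.eq_of_lt _ (by simp),
    fun j s hs => ?_⟩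
  · exact (mem_of_dist_ne_top ((hy 0).trans_lt ENNReal.ofReal_lt_top).ne).2
  · obtain ⟨i, hi⟩ := hY.exists_dist_waypoint_le (by positivity) hgapκ hs
    refine ⟨t i, ht.mem i, (dist_triangle _ (y i) _).trans ?_⟩
    rw [dist_comm (y i)]
    refine (add_le_add hi (hy i)).trans ?_
    rw [← ENNReal.ofReal_add (by positivity) (herr0 _)]
    exact ENNReal.ofReal_le_ofReal (by linarith [herr i])
  · exact (ht.dist_waypoint_le hx herr0 hy j hs).trans
      (ENNReal.ofReal_le_ofReal (by linarith [herr j]))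

end IsEquipartition

end System

/-! ### Independent samples -/

section Sampling

variable {X ι α : Type*}

/-- The sample `v` misses the set `B`: none of its points lies in `B`. -/
def Misses (v : ι → X) (B : Set X) : Prop := ∀ k, v k ∉ B

variable [MeasurableSpace X] [Fintype ι] {ν : Measure X} [IsProbabilityMeasure ν]

theorem pi_misses_le {B : Set X} (hB : MeasurableSet B) {b : ℝ}
    (hb : ENNReal.ofReal b ≤ ν B) :
    Measure.pi (fun _ : ι => ν) {v | Misses v B} ≤
      ENNReal.ofReal (Real.exp (-(Fintype.card ι * b))) := by
  have hset : {v : ι → X | Misses v B} = univ.pi fun _ => Bᶜ := by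
    ext v
    simp [Misses]
  have hcompl : ν Bᶜ ≤ ENNReal.ofReal (Real.exp (-b)) := by
    rw [prob_compl_eq_one_sub hB, tsub_le_iff_right]
    calc (1 : ℝ≥0∞) = ENNReal.ofReal 1 := ENNReal.ofReal_one.symm
      _ ≤ ENNReal.ofReal (Real.exp (-b) + b) :=
        ENNReal.ofReal_le_ofReal (by linarith [Real.add_one_le_exp (-b)])
      _ ≤ ENNReal.ofReal (Real.exp (-b)) + ν B := ENNReal.ofReal_add_le.trans (by gcongr)
  rw [hset, Measure.pi_pi, Finset.prod_const, Finset.card_univ]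
  calc ν Bᶜ ^ Fintype.card ι ≤ ENNReal.ofReal (Real.exp (-b)) ^ Fintype.card ι := by gcongr
    _ = _ := by rw [← ENNReal.ofReal_pow (Real.exp_pos _).le, ← Real.exp_nat_mul, mul_neg]

theorem pi_exists_misses_le {s : Finset α} {B : α → Set X}
    (hB : ∀ i ∈ s, MeasurableSet (B i)) {b : ℝ} (hb : ∀ i ∈ s, ENNReal.ofReal b ≤ ν (B i)) :
    Measure.pi (fun _ : ι => ν) {v | ∃ i ∈ s, Misses v (B i)} ≤
      ENNReal.ofReal (s.card * Real.exp (-(Fintype.card ι * b))) := by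
  have hset : {v : ι → X | ∃ i ∈ s, Misses v (B i)} = ⋃ i ∈ s, {v | Misses v (B i)} := by
    ext v; simp
  rw [hset, ENNReal.ofReal_mul (by positivity), ENNReal.ofReal_natCast, ← nsmul_eq_mul]
  exact (measure_biUnion_finset_le _ _).trans
    (Finset.sum_le_card_nsmul _ _ _ fun i hi => pi_misses_le (hB i hi) (hb i hi))

theorem pi_forall_misses_le {s : Finset α} {Q : α → Set X}
    (hQ : ∀ i ∈ s, MeasurableSet (Q i)) (hdisj : (s : Set α).PairwiseDisjoint Q) {c : ℝ}
    (hc : ∀ i ∈ s, ENNReal.ofReal c ≤ ν (Q i)) :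
    Measure.pi (fun _ : ι => ν) {v | ∀ i ∈ s, Misses v (Q i)} ≤
      ENNReal.ofReal (Real.exp (-(Fintype.card ι * (s.card * c)))) := by
  have hset : {v : ι → X | ∀ i ∈ s, Misses v (Q i)} = {v | Misses v (⋃ i ∈ s, Q i)} := by
    ext v
    simp only [Misses, mem_ofPred_eq, mem_iUnion, not_exists]
    exact ⟨fun h k i hi => h i hi k, fun h i hi k => h k i hi⟩
  rw [hset]
  refine pi_misses_le (s.measurableSet_biUnion hQ) ?_
  rw [measure_biUnion_finset hdisj hQ, ENNReal.ofReal_mul (by positivity), ENNReal.ofReal_natCast,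
    ← nsmul_eq_mul]
  exact Finset.card_nsmul_le_sum _ _ _ hc

open scoped Classical in
theorem pi_le_card_filter_misses_le {s : Finset α} {Q : α → Set X}
    (hQ : ∀ i ∈ s, MeasurableSet (Q i)) (hdisj : (s : Set α).PairwiseDisjoint Q) {c : ℝ}
    (hc0 : 0 ≤ c) (hc : ∀ i ∈ s, ENNReal.ofReal c ≤ ν (Q i)) (a : ℝ) :
    Measure.pi (fun _ : ι => ν) {v | a ≤ (s.filter fun i => Misses v (Q i)).card} ≤
      ENNReal.ofReal (2 ^ s.card * Real.exp (-(Fintype.card ι * (a * c)))) := by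
  set 𝓕 := s.powerset.filter fun F => a ≤ F.card
  have hcover : {v : ι → X | a ≤ (s.filter fun i => Misses v (Q i)).card} ⊆
      ⋃ F ∈ 𝓕, {v | ∀ i ∈ F, Misses v (Q i)} := fun v hv => mem_biUnion
    (Finset.mem_filter.2 ⟨Finset.mem_powerset.2 (Finset.filter_subset _ _), hv⟩)
    fun i hi => (Finset.mem_filter.1 hi).2
  have hcard : 𝓕.card ≤ 2 ^ s.card :=
    (Finset.card_filter_le _ _).trans (Finset.card_powerset s).le
  calc _ ≤ ∑ F ∈ 𝓕, Measure.pi (fun _ : ι => ν) {v | ∀ i ∈ F, Misses v (Q i)} :=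
        (measure_mono hcover).trans (measure_biUnion_finset_le _ _)
    _ ≤ 𝓕.card • ENNReal.ofReal (Real.exp (-(Fintype.card ι * (a * c)))) := by
        refine Finset.sum_le_card_nsmul _ _ _ fun F hF => ?_
        obtain ⟨hFs, haF⟩ := Finset.mem_filter.1 hF
        rw [Finset.mem_powerset] at hFs
        refine (pi_forall_misses_le (fun i hi => hQ i (hFs hi))
          (hdisj.subset (Finset.coe_subset.2 hFs)) fun i hi => hc i (hFs hi)).trans ?_
        gcongr
    _ ≤ _ := by
        rw [nsmul_eq_mul, ENNReal.ofReal_mul (by positivity)]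
        gcongr
        rw [← ENNReal.ofReal_natCast]
        exact ENNReal.ofReal_le_ofReal (by exact_mod_cast hcard)

end Sampling

/-! ### Counting the missed waypoints -/

open scoped Classical in
theorem sum_ite_add_ite_succ_add_le {a b : ℝ} (ha : 0 ≤ a) (hb : 0 ≤ b) (U : ℕ → Prop) (M : ℕ) :
    ∑ j ∈ Finset.range M, ((if U j then a else b) + (if U (j + 1) then a else b) + b) ≤
      3 * (M + 1) * b + 2 * a * ((Finset.range (M + 1)).filter U).card := by
  set e : ℕ → ℝ := fun j => if U j then a else b
  have he0 : ∀ j, 0 ≤ e j := fun j => by dsimp only [e]; split_ifs <;> assumption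
  have hrange : ∑ j ∈ Finset.range (M + 1), e j ≤
      (M + 1) * b + a * ((Finset.range (M + 1)).filter U).card := by
    calc ∑ j ∈ Finset.range (M + 1), e j
        ≤ ∑ j ∈ Finset.range (M + 1), (b + if U j then a else 0) := by
          gcongr with j
          dsimp only [e]
          split_ifs <;> linarith
      _ = _ := by
          rw [Finset.sum_add_distrib, ← Finset.sum_filter]
          simp [mul_comm]
  have hleft : ∑ j ∈ Finset.range M, e j ≤ ∑ j ∈ Finset.range (M + 1), e j := by
    rw [Finset.sum_range_succ]
    linarith [he0 M]
  have hright : ∑ j ∈ Finset.range M, e (j + 1) ≤ ∑ j ∈ Finset.range (M + 1), e j := by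
    rw [Finset.sum_range_succ']
    linarith [he0 0]
  rw [Finset.sum_add_distrib, Finset.sum_add_distrib, Finset.sum_const, Finset.card_range,
    nsmul_eq_mul]
  linarith

open scoped Classical in
theorem card_filter_range_succ_le (U : ℕ → Prop) (M P : ℕ) (G : ℕ → Finset ℕ) :
    ((Finset.range (M + 1)).filter U).card ≤
      1 + (Finset.Ioc 0 M \ (Finset.range P).biUnion G).card +
        ∑ j ∈ Finset.range P, ((G j).filter U).card := by
  have hcover : (Finset.range (M + 1)).filter U ⊆
      {0} ∪ (Finset.Ioc 0 M \ (Finset.range P).biUnion G) ∪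
        (Finset.range P).biUnion fun j => (G j).filter U := by
    intro i
    simp only [Finset.mem_filter, Finset.mem_range, Finset.mem_union, Finset.mem_singleton,
      Finset.mem_sdiff, Finset.mem_Ioc, Finset.mem_biUnion]
    grind
  calc _ ≤ _ := Finset.card_le_card hcover
    _ ≤ _ := (Finset.card_union_le _ _).trans
      (add_le_add (Finset.card_union_le _ _) Finset.card_biUnion_le)

namespace System

variable {N m : ℕ} {S : System N m} {x : ℝ → E N} {T : ℝ}

/-! ### Sampling from the free space -/

theorem measurableSet_free (Mobs : Set (E N)) : MeasurableSet (S.free Mobs) :=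
  isClosed_closure.measurableSet.inter S.isOpen_M.measurableSet

theorem volume_free_pos {Mobs : Set (E N)} (hopen : IsOpen (S.M \ Mobs))
    (hne : (S.free Mobs).Nonempty) : 0 < volume (S.free Mobs) := by
  have hne' : (S.M \ Mobs).Nonempty := closure_nonempty_iff.1 (hne.mono inter_subset_left)
  exact (hopen.measure_pos volume hne').trans_le
    (measure_mono fun p hp => ⟨subset_closure hp, hp.1⟩)

theorem ofReal_div_le_cond_free {Mobs Q : Set (E N)} (hvol : volume (S.free Mobs) ≠ ⊤)
    (hpos : 0 < volume (S.free Mobs)) (hQ : Q ⊆ S.free Mobs) {c : ℝ}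
    (hc : ENNReal.ofReal c ≤ volume Q) :
    ENNReal.ofReal (c / (volume (S.free Mobs)).toReal) ≤
      ProbabilityTheory.cond volume (S.free Mobs) Q := by
  rw [ProbabilityTheory.cond_apply (measurableSet_free Mobs), inter_eq_right.2 hQ,
    ENNReal.ofReal_div_of_pos (ENNReal.toReal_pos hpos.ne' hvol), ENNReal.ofReal_toReal hvol,
    ENNReal.div_eq_inv_mul]
  gcongr

/-- The ball of radius `R` around `p` for the control distance has `ν`-mass at least `b`. Only a
measurable part of the ball is asked for, so that the ball itself need not be measurable. -/
def HasBallMass (S : System N m) (ν : Measure (E N)) (p : E N) (R b : ℝ) : Prop :=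
  ∃ Q : Set (E N), MeasurableSet Q ∧ ENNReal.ofReal b ≤ ν Q ∧
    ∀ q ∈ Q, S.dist p q ≤ ENNReal.ofReal R

/-- The measure `ν` is lower Ahlfors regular of dimension `D` along the trajectory `x` on `[0,T]`:
small balls of radius `A * ρ` around its points have mass at least `ρ ^ D / μ`. -/
def IsLowerRegularAlong (S : System N m) (ν : Measure (E N)) (x : ℝ → E N) (T A μ : ℝ) (D : ℕ) :
    Prop :=
  ∃ ρ₀ > 0, ∀ t ∈ Icc 0 T, ∀ ρ ∈ Icc 0 ρ₀, S.HasBallMass ν (x t) (A * ρ) (ρ ^ D / μ)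

theorem Assumptions.isLowerRegularAlong [NeZero N] {aMin AMax σMin θMin : ℝ}
    (hS : S.Assumptions aMin AMax σMin θMin) {Mobs : Set (E N)} (hopen : IsOpen (S.M \ Mobs))
    (hvol : volume (S.free Mobs) ≠ ⊤) (hx : S.IsTrajectory x T) {δ : ℝ} (hδ : 0 < δ)
    (hclear : S.StrongClearance Mobs δ x T) :
    S.IsLowerRegularAlong (ProbabilityTheory.cond volume (S.free Mobs)) x T AMax
      (volume (S.free Mobs)).toReal (S.homDim (x 0)) := by
  have hA := hS.AMax_pos
  obtain ⟨c, hc, hcM⟩ := (isCompact_Icc.image_of_continuousOn hx.2.1).exists_cthickening_subset_open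
    S.isOpen_M (image_subset_iff.2 hx.2.2.1)
  have hpos := volume_free_pos hopen ⟨x 0, (hclear 0 (left_mem_Icc.2 hx.1)).1⟩
  set κ := min c (min (σMin / 2) (δ / 2))
  have hκ : 0 < κ := lt_min hc (lt_min (half_pos hS.σMin_pos) (half_pos hδ))
  have hκc : κ ≤ c := min_le_left _ _
  have hκσ : κ ≤ σMin / 2 := (min_le_right _ _).trans (min_le_left _ _)
  have hκδ : κ ≤ δ / 2 := (min_le_right _ _).trans (min_le_right _ _)
  refine ⟨κ / AMax, by positivity, fun t ht ρ ⟨hρ0, hρ⟩ => ?_⟩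
  rw [le_div_iff₀' hA] at hρ
  have hball : Metric.closedBall (x t) (AMax * ρ) ⊆ S.M :=
    (Metric.closedBall_subset_closedBall (hρ.trans hκc)).trans
      ((Metric.closedBall_subset_cthickening (mem_image_of_mem x ht) c).trans hcM)
  obtain ⟨Q, hQ, hQvol, hQdist⟩ := hS.exists_box (hx.2.2.1 t ht) hρ0
    (by linarith [hS.σMin_pos]) hball
  refine ⟨Q, hQ, ofReal_div_le_cond_free hvol hpos (fun q hq => ?_) ?_, hQdist⟩
  · have hxq : ‖x t - q‖ ≤ AMax * ρ := (ENNReal.ofReal_le_ofReal_iff (by positivity)).1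
      ((norm_sub_le_dist (S := S) _ _).trans (hQdist q hq))
    have hqM : q ∈ S.M := hball (by rwa [Metric.mem_closedBall, dist_eq_norm, norm_sub_rev])
    exact ⟨subset_closure ⟨hqM, fun hqo => by linarith [(hclear t ht).2 q hqo]⟩, hqM⟩
  · rw [hQvol, hx.homDim_eq hS.regular ht]
    exact ENNReal.ofReal_le_ofReal
      (le_mul_of_one_le_left (by positivity) (one_le_pow₀ one_le_two))

/-! ### The probability of failure -/

theorem disjoint_of_dist_le {p p' : E N} {Q Q' : Set (E N)} {R : ℝ} (hR : 0 ≤ R)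
    (hQ : ∀ q ∈ Q, S.dist p q ≤ ENNReal.ofReal R) (hQ' : ∀ q ∈ Q', S.dist p' q ≤ ENNReal.ofReal R)
    (h : 2 * R < ‖p - p'‖) : Disjoint Q Q' := by
  have hnorm : ∀ {p q : E N}, S.dist p q ≤ ENNReal.ofReal R → ‖p - q‖ ≤ R := fun hpq =>
    (ENNReal.ofReal_le_ofReal_iff hR).1 ((norm_sub_le_dist _ _).trans hpq)
  refine Set.disjoint_left.2 fun q hq hq' => ?_
  have htri := norm_sub_le_norm_sub_add_norm_sub p q p'
  rw [norm_sub_rev q] at htri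
  linarith [hnorm (hQ q hq), hnorm (hQ' q hq')]

theorem IsEquipartition.mem_traceEvent {M n : ℕ} {h r ε : ℝ} {t : ℕ → ℝ} {xinit : E N}
    {v : Fin n → E N} (ht : IsEquipartition x T M h t) (hx : S.IsTrajectory x T)
    (hh : h ≤ r / 2) {err : ℕ → ℝ} (herr0 : ∀ i, 0 ≤ err i) (herr : ∀ i, err i ≤ r / 4)
    (hhit : ∀ i ≤ M, ∃ k, S.dist (x (t i)) (v k) ≤ ENNReal.ofReal (err i)) {κ : ℝ≥0}
    (hκ : 0 < κ) (hκr : κ ≤ r / 2)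
    (hsum : ∑ j ∈ Finset.range M, (err j + err (j + 1) + κ) ≤ ε * lengthTo x T) :
    v ∈ S.traceEvent xinit x T ε r n := by
  have hwaypoint : ∀ i : Fin (M + 1), ∃ q ∈ insert xinit (range v),
      S.dist (x (t i)) q ≤ ENNReal.ofReal (err i) ∧ (x 0 = xinit → i = 0 → q = xinit) := by
    intro i
    by_cases h0 : x 0 = xinit ∧ i = 0
    · refine ⟨xinit, mem_insert _ _, ?_, fun _ _ => rfl⟩
      rw [h0.2, Fin.val_zero, ht.zero, ← h0.1, dist_self (hx.2.2.1 0 (left_mem_Icc.2 hx.1))]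
      exact zero_le
    · obtain ⟨k, hk⟩ := hhit i (Nat.lt_succ_iff.1 i.2)
      exact ⟨v k, mem_insert_of_mem _ (mem_range_self k), hk, fun h1 h2 => absurd ⟨h1, h2⟩ h0⟩
  choose y hyV hyd hy0 using hwaypoint
  exact ⟨M, y, hyV, ht.traces hx hh herr0 herr hyd hκ hκr hsum, fun h0 => hy0 0 h0 rfl⟩

theorem IsTrajectory.measure_compl_traceEvent_le_of_lengthTo_eq_zero (hx : S.IsTrajectory x T)
    (hL : lengthTo x T = 0) {ν : Measure (E N)} [IsProbabilityMeasure ν] {r b : ℝ} (hr : 0 < r)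
    (hb : S.HasBallMass ν (x 0) (r / 4) b) (xinit : E N) (ε : ℝ) (n : ℕ) :
    Measure.pi (fun _ : Fin n => ν) (S.traceEvent xinit x T ε r n)ᶜ ≤
      ENNReal.ofReal (Real.exp (-(n * b))) := by
  obtain ⟨B, hB, hνB, hBdist⟩ := hb
  obtain ⟨t, ht⟩ := hx.exists_isEquipartition (M := 0) (half_pos hr) (by simp [hL])
  have hfail : (S.traceEvent xinit x T ε r n)ᶜ ⊆ {v | Misses v B} := by
    refine fun v hv k hk => hv ?_
    refine ht.mem_traceEvent hx le_rfl (err := fun _ => r / 4) (fun _ => by positivity)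
      (fun _ => le_rfl) (fun i hi => ⟨k, ?_⟩) (κ := (r / 2).toNNReal)
      (Real.toNNReal_pos.2 (half_pos hr)) (Real.coe_toNNReal _ (half_pos hr).le).le (by simp [hL])
    rw [Nat.le_zero.1 hi, ht.zero]
    exact hBdist _ hk
  simpa only [Fintype.card_fin] using
    (measure_mono hfail).trans (pi_misses_le (ι := Fin n) hB hνB)

namespace IsEquipartition

variable {M n : ℕ} {h r ε β : ℝ} {t : ℕ → ℝ} {xinit : E N} {v : Fin n → E N}

open scoped Classical in
theorem mem_traceEvent_of_card_le (ht : IsEquipartition x T M h t) (hx : S.IsTrajectory x T)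
    (hh : h ≤ r / 2) (hMr : (M + 1) * r ≤ 4 * lengthTo x T) (hβ0 : 0 < β) (hβ1 : β ≤ 1)
    (hβε : β ≤ ε / 12) {U : ℕ → Prop}
    (hhit : ∀ i ≤ M, ∃ k, S.dist (x (t i)) (v k) ≤ ENNReal.ofReal (r / 4))
    (hhitβ : ∀ i, ¬U i → ∃ k, S.dist (x (t i)) (v k) ≤ ENNReal.ofReal (β * (r / 4)))
    (hU : r * ((Finset.range (M + 1)).filter U).card ≤ 3 / 2 * (ε * lengthTo x T)) :
    v ∈ S.traceEvent xinit x T ε r n := by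
  have hr : 0 < r := by linarith [ht.step_pos]
  have hβr : β * (r / 4) ≤ r / 4 := mul_le_of_le_one_left (by positivity) hβ1
  have hκ : ((β * (r / 4)).toNNReal : ℝ) = β * (r / 4) := Real.coe_toNNReal _ (by positivity)
  refine ht.mem_traceEvent hx hh (err := fun i => if U i then r / 4 else β * (r / 4))
    (κ := (β * (r / 4)).toNNReal) (fun i => ?_) (fun i => ?_) (fun i hi => ?_)
    (Real.toNNReal_pos.2 (by positivity)) (by linarith) ?_
  · split_ifs <;> positivity
  · split_ifs
    exacts [le_rfl, hβr]
  · split_ifs with hi'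
    exacts [hhit i hi, hhitβ i hi']
  · have hsmall : β * ((M + 1) * r) ≤ ε / 12 * (4 * lengthTo x T) :=
      mul_le_mul hβε hMr (by positivity) (hβ0.le.trans hβε)
    rw [hκ]
    refine (sum_ite_add_ite_succ_add_le (by positivity) (by positivity) U M).trans ?_
    linarith

open scoped Classical in
theorem mul_card_filter_le (ht : IsEquipartition x T M h t) (hh : r / 3 ≤ h) (hh' : h ≤ r / 2)
    (hε : 0 ≤ ε) {P : ℕ} (hrP : r * (6 * P + 1) ≤ ε * lengthTo x T / 2)
    {G : ℕ → Finset ℕ} (hGcard : h / 2 * (Finset.Ioc 0 M \ (Finset.range P).biUnion G).card ≤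
      ε * lengthTo x T / 24 + 2 * P * h)
    {U : ℕ → Prop} (hU : ∀ j < P, ((G j).filter U).card ≤ ε * M / (4 * (P + 1))) :
    r * ((Finset.range (M + 1)).filter U).card ≤ 3 / 2 * (ε * lengthTo x T) := by
  have hr : 0 < r := by linarith [ht.step_pos]
  set bad := (Finset.Ioc 0 M \ (Finset.range P).biUnion G).card
  have hmissed : ∑ j ∈ Finset.range P, (((G j).filter U).card : ℝ) ≤ ε * M / 4 := by
    calc _ ≤ P * (ε * M / (4 * (P + 1))) := by
          simpa using Finset.sum_le_card_nsmul _ _ _ fun j hj => hU j (Finset.mem_range.1 hj)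
      _ ≤ (P + 1) * (ε * M / (4 * (P + 1))) := by gcongr; linarith
      _ = ε * M / 4 := by field_simp
  have hbad : r * bad ≤ ε * lengthTo x T / 4 + 6 * (P * r) := by
    have hlow : r / 6 * bad ≤ h / 2 * bad :=
      mul_le_mul_of_nonneg_right (by linarith) (Nat.cast_nonneg _)
    have hhigh : 2 * P * h ≤ 2 * P * (r / 2) := by gcongr
    linarith
  have hMr : M * (r / 3) ≤ lengthTo x T := ht.mul_step ▸ by gcongr
  have hεMr : ε * (M * (r / 3)) ≤ ε * lengthTo x T := by gcongr
  calc r * ((Finset.range (M + 1)).filter U).card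
      ≤ r * (1 + bad + ∑ j ∈ Finset.range P, (((G j).filter U).card : ℝ)) := by
        gcongr
        exact_mod_cast card_filter_range_succ_le U M P G
    _ ≤ r * (1 + bad + ε * M / 4) := by gcongr
    _ ≤ _ := by linarith

theorem measure_compl_traceEvent_le (ht : IsEquipartition x T M h t) (hx : S.IsTrajectory x T)
    (hh : r / 3 ≤ h) (hh' : h ≤ r / 2) (hrL : r ≤ lengthTo x T) (hβ0 : 0 < β) (hβ1 : β ≤ 1 / 4)
    (hβε : β ≤ ε / 12) {P : ℕ} (hrP : r * (6 * P + 1) ≤ ε * lengthTo x T / 2) {G : ℕ → Finset ℕ}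
    (hG : ∀ j, G j ⊆ Finset.Ioc 0 M)
    (hGsep : ∀ j, (G j : Set ℕ).Pairwise fun i i' => h / 2 ≤ ‖x (t i) - x (t i')‖)
    (hGcard : h / 2 * (Finset.Ioc 0 M \ (Finset.range P).biUnion G).card ≤
      ε * lengthTo x T / 24 + 2 * P * h)
    {ν : Measure (E N)} [IsProbabilityMeasure ν] {b c : ℝ} (hc : 0 ≤ c)
    (hmass : ∀ i, S.HasBallMass ν (x (t i)) (r / 4) b)
    (hmassβ : ∀ i, S.HasBallMass ν (x (t i)) (β * (r / 4)) c) (xinit : E N) (n : ℕ) :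
    Measure.pi (fun _ : Fin n => ν) (S.traceEvent xinit x T ε r n)ᶜ ≤
      ENNReal.ofReal ((M + 1) * Real.exp (-(n * b)) +
        P * (2 ^ M * Real.exp (-(n * (ε * M / (4 * (P + 1)) * c))))) := by
  classical
  have hr : 0 < r := by linarith [ht.step_pos]
  have hε : 0 ≤ ε := by linarith
  have hMr : M * (r / 3) ≤ lengthTo x T := ht.mul_step ▸ by gcongr
  have hβr : β * (r / 4) ≤ 1 / 4 * (r / 4) := by gcongr
  choose B hB hνB hBdist using hmass
  choose Q hQ hνQ hQdist using hmassβ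
  have hdisj : ∀ j, (G j : Set ℕ).PairwiseDisjoint Q := fun j => (hGsep j).mono' fun i i' hii' =>
    disjoint_of_dist_le (by positivity) (hQdist i) (hQdist i') (by linarith)
  have hfail : (S.traceEvent xinit x T ε r n)ᶜ ⊆
      {v | ∃ i ∈ Finset.range (M + 1), Misses v (B i)} ∪ ⋃ j ∈ Finset.range P,
        {v | ε * M / (4 * (P + 1)) ≤ ((G j).filter fun i => Misses v (Q i)).card} := by
    refine fun v => not_imp_comm.1 fun hv => ?_
    simp only [mem_union, mem_iUnion, mem_ofPred_eq, not_or, not_exists, not_and, not_le,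
      Finset.mem_range] at hv
    refine ht.mem_traceEvent_of_card_le hx hh' (by linarith) hβ0 (by linarith) hβε
      (U := fun i => Misses v (Q i)) (fun i hi => ?_) (fun i hi => ?_)
      (ht.mul_card_filter_le hh hh' hε hrP hGcard fun j hj => (hv.2 j hj).le)
    · exact (not_forall_not.1 (hv.1 i (Nat.lt_succ_of_le hi))).imp fun k => hBdist i _
    · exact (not_forall_not.1 hi).imp fun k => hQdist i _
  rw [ENNReal.ofReal_add (by positivity) (by positivity)]
  refine (measure_mono hfail).trans ((measure_union_le _ _).trans (add_le_add ?_ ?_))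
  · simpa only [Fintype.card_fin, Finset.card_range, Nat.cast_add, Nat.cast_one] using
      pi_exists_misses_le (ι := Fin n) (s := Finset.range (M + 1)) (fun i _ => hB i)
        fun i _ => hνB i
  · rw [ENNReal.ofReal_mul (Nat.cast_nonneg _), ENNReal.ofReal_natCast, ← nsmul_eq_mul]
    refine (measure_biUnion_finset_le _ _).trans
      ((Finset.sum_le_card_nsmul _ _ _ fun j _ => ?_).trans_eq (by rw [Finset.card_range]))
    refine (pi_le_card_filter_misses_le (fun i _ => hQ i) (hdisj j) hc (fun i _ => hνQ i)
      _).trans (ENNReal.ofReal_le_ofReal ?_)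
    rw [Fintype.card_fin]
    gcongr
    · exact one_le_two
    · simpa using Finset.card_le_card (hG j)

end IsEquipartition

end System

/-! ### The rate of decay -/

/-- The solution `ρ` of `ρ ^ D = K * (log n / n)`: the size at which a box of dimension `D` has
volume proportional to `log n / n`. -/
def scale (K : ℝ) (D n : ℕ) : ℝ := (K * (Real.log n / n)) ^ (1 / (D : ℝ))

/-- The bound `n ^ (-η / D) * (log n) ^ (-1 / D)` of the theorem. -/
def rate (η : ℝ) (D n : ℕ) : ℝ := (n : ℝ) ^ (-(η / D)) * Real.log n ^ (-(1 / (D : ℝ)))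

theorem rate_nonneg (η : ℝ) (D n : ℕ) : 0 ≤ rate η D n :=
  mul_nonneg (Real.rpow_nonneg (Nat.cast_nonneg n) _)
    (Real.rpow_nonneg (Real.log_natCast_nonneg n) _)

theorem log_natCast_pos {n : ℕ} (hn : 1 < n) : 0 < Real.log n :=
  Real.log_pos (Nat.one_lt_cast.2 hn)

theorem scale_pos {K : ℝ} (hK : 0 < K) (D : ℕ) {n : ℕ} (hn : 1 < n) : 0 < scale K D n :=
  Real.rpow_pos_of_pos (mul_pos hK (div_pos (log_natCast_pos hn) (by positivity))) _

theorem scale_pow {K : ℝ} (hK : 0 ≤ K) {D : ℕ} (hD : D ≠ 0) (n : ℕ) :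
    scale K D n ^ D = K * (Real.log n / n) := by
  rw [scale, one_div]
  have := Real.log_natCast_nonneg n
  exact Real.rpow_inv_natCast_pow (by positivity) hD

theorem tendsto_scale (K : ℝ) {D : ℕ} (hD : D ≠ 0) : Tendsto (scale K D) atTop (𝓝 0) := by
  have hlog : Tendsto (fun n : ℕ => Real.log n / (n : ℝ)) atTop (𝓝 0) :=
    Real.isLittleO_log_id_atTop.tendsto_div_nhds_zero.comp tendsto_natCast_atTop_atTop
  have hpow := (hlog.const_mul K).rpow_const (p := 1 / (D : ℝ)) (.inr (by positivity))
  rwa [mul_zero, Real.zero_rpow (by positivity)] at hpow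

theorem mul_scale_pow_div {η μ : ℝ} (hη : 0 ≤ η) (hμ : 0 < μ) {D n : ℕ} (hD : D ≠ 0)
    (hn : n ≠ 0) :
    n * (scale ((1 + η) * (μ / D)) D n ^ D / μ) = (1 + η) / D * Real.log n := by
  rw [scale_pow (by positivity) hD]
  field_simp

theorem exp_neg_mul_log {n : ℕ} (hn : n ≠ 0) (η : ℝ) (D : ℕ) :
    Real.exp (-((1 + η) / D * Real.log n)) = (n : ℝ) ^ (-(η / D)) * (n : ℝ) ^ (-(1 / (D : ℝ))) := by
  have hn0 : (0 : ℝ) < n := by positivity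
  rw [← Real.rpow_add hn0, Real.rpow_def_of_pos hn0]
  ring_nf

theorem exp_neg_mul_log_le_rate {n : ℕ} (hn : 1 < n) (η : ℝ) (D : ℕ) :
    Real.exp (-((1 + η) / D * Real.log n)) ≤ rate η D n := by
  rw [exp_neg_mul_log (by lia), rate]
  refine mul_le_mul_of_nonneg_left ?_ (by positivity)
  exact Real.rpow_le_rpow_of_nonpos (log_natCast_pos hn) (Real.log_le_self n.cast_nonneg)
    (neg_nonpos.2 (by positivity))

theorem inv_scale_mul_exp {K : ℝ} (hK : 0 ≤ K) (η : ℝ) (D : ℕ) {n : ℕ} (hn : n ≠ 0) :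
    (scale K D n)⁻¹ * Real.exp (-((1 + η) / D * Real.log n)) =
      (K ^ (1 / (D : ℝ)))⁻¹ * rate η D n := by
  have hn0 : (0 : ℝ) < n := by positivity
  have hlog := Real.log_natCast_nonneg n
  rw [exp_neg_mul_log hn, rate, scale, Real.mul_rpow hK (by positivity),
    Real.div_rpow hlog hn0.le, Real.rpow_neg hlog, Real.rpow_neg hn0.le (1 / D)]
  have hn1 : (n : ℝ) ^ (1 / (D : ℝ)) ≠ 0 := (Real.rpow_pos_of_pos hn0 _).ne'
  field_simp

theorem two_pow_mul_exp_le {M : ℕ} {c l ζ : ℝ} (hl : 0 ≤ l) (hcl : 2 ≤ c * l)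
    (hζ : 2 * ζ ≤ c * M) : 2 ^ M * Real.exp (-(c * M * l)) ≤ Real.exp (-(ζ * l)) := by
  have htwo : (2 : ℝ) ≤ Real.exp 1 := by linarith [Real.add_one_le_exp (1 : ℝ)]
  have hM : 2 * M ≤ c * l * M := by gcongr
  have hζl : 2 * ζ * l ≤ c * M * l := by gcongr
  calc 2 ^ M * Real.exp (-(c * M * l))
      ≤ Real.exp 1 ^ M * Real.exp (-(c * M * l)) := by gcongr
    _ = Real.exp (M - c * M * l) := by
      rw [← Real.exp_nat_mul, ← Real.exp_add, mul_one, sub_eq_add_neg]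
    _ ≤ Real.exp (-(ζ * l)) := Real.exp_le_exp.2 (by linarith)

theorem exists_step {L r : ℝ} (hr : 0 < r) (hrL : r ≤ L) :
    ∃ (M : ℕ) (h : ℝ), 0 < h ∧ M * h = L ∧ r / 3 ≤ h ∧ h ≤ r / 2 := by
  have hL : 0 < L := hr.trans_le hrL
  have : 0 < ⌈2 * L / r⌉₊ := Nat.ceil_pos.2 (by positivity)
  have hlow : 2 * L ≤ ⌈2 * L / r⌉₊ * r := (div_le_iff₀ hr).1 (Nat.le_ceil _)
  have hhigh : ⌈2 * L / r⌉₊ * r < 2 * L + r := by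
    rw [← lt_div_iff₀ hr, add_div, div_self hr.ne']
    exact Nat.ceil_lt_add_one (by positivity)
  refine ⟨⌈2 * L / r⌉₊, L / ⌈2 * L / r⌉₊, by positivity, by field_simp, ?_, ?_⟩
  · rw [le_div_iff₀ (by positivity)]
    linarith
  · rw [div_le_iff₀ (by positivity)]
    linarith

theorem isBigO_toReal_of_eventually_le {f : ℕ → ℝ≥0∞} {g : ℕ → ℝ} {C : ℝ} (hC : 0 ≤ C)
    (hg : ∀ n, 0 ≤ g n) (hfg : ∀ᶠ n in atTop, f n ≤ ENNReal.ofReal (C * g n)) :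
    (fun n => (f n).toReal) =O[atTop] g := by
  refine Asymptotics.IsBigO.of_bound C (hfg.mono fun n hn => ?_)
  rw [Real.norm_of_nonneg ENNReal.toReal_nonneg, Real.norm_of_nonneg (hg n)]
  exact ENNReal.toReal_le_of_le_ofReal (mul_nonneg hC (hg n)) hn

namespace System

variable {N m : ℕ} {S : System N m} {x : ℝ → E N} {T : ℝ}

theorem radius_eq {AMax η vol : ℝ} (hη : 0 ≤ η) (hvol : 0 ≤ vol) (D n : ℕ) :
    radius AMax η vol D n = 4 * (AMax * scale ((1 + η) * (vol / D)) D n) := by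
  have := Real.log_natCast_nonneg n
  rw [radius, scale, Real.mul_rpow (by positivity) (by positivity),
    Real.mul_rpow (by positivity) (by positivity)]
  ring

/-! ### The probability of failure for small radii -/

theorem IsTrajectory.exists_measure_compl_traceEvent_le (hx : S.IsTrajectory x T)
    (hL : 0 < lengthTo x T) {ε : ℝ} (hε : 0 < ε) :
    ∃ P : ℕ, ∃ β ∈ Ioc (0 : ℝ) (1 / 4), ∃ r₀ > 0, ∀ r ∈ Ioc 0 r₀, ∃ M : ℕ,
      2 * lengthTo x T ≤ M * r ∧ (M + 1) * r ≤ 4 * lengthTo x T ∧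
      ∀ (ν : Measure (E N)) [IsProbabilityMeasure ν] (b c : ℝ), 0 ≤ c →
        (∀ t ∈ Icc 0 T, S.HasBallMass ν (x t) (r / 4) b) →
        (∀ t ∈ Icc 0 T, S.HasBallMass ν (x t) (β * (r / 4)) c) → ∀ (xinit : E N) (n : ℕ),
        Measure.pi (fun _ : Fin n => ν) (S.traceEvent xinit x T ε r n)ᶜ ≤
          ENNReal.ofReal ((M + 1) * Real.exp (-(n * b)) +
            P * (2 ^ M * Real.exp (-(n * (ε * M / (4 * (P + 1)) * c))))) := by
  obtain ⟨P, hP⟩ := hx.exists_separated_families (e := ε * lengthTo x T / 24) (by positivity)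
  refine ⟨P, min (1 / 4) (ε / 12), ⟨by positivity, min_le_left _ _⟩,
    min (lengthTo x T) (ε * lengthTo x T / 2 / (6 * P + 1)), by positivity, ?_⟩
  rintro r ⟨hr0, hr⟩
  obtain ⟨hrL, hrP⟩ := le_min_iff.1 hr
  obtain ⟨M, h, hh0, hMh, hh, hh'⟩ := exists_step hr0 hrL
  have hMlow : M * (r / 3) ≤ M * h := by gcongr
  have hMhigh : M * h ≤ M * (r / 2) := by gcongr
  obtain ⟨t, ht⟩ := hx.exists_isEquipartition hh0 hMh
  obtain ⟨G, hG, hGsep, hGcard⟩ := hP M h t ht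
  refine ⟨M, by linarith, by linarith, fun ν _ b c hc hb hb' xinit n => ?_⟩
  exact ht.measure_compl_traceEvent_le hx hh hh' hrL (by positivity) (min_le_left _ _)
    (min_le_right _ _) ((le_div_iff₀ (by positivity)).1 hrP) hG hGsep hGcard hc
    (fun i => hb _ (ht.mem i)) (fun i => hb' _ (ht.mem i)) xinit n

/-! ### The rate for lower regular laws -/

section LowerRegular

variable {A η μ ε : ℝ} {D : ℕ} {ν : Measure (E N)} [IsProbabilityMeasure ν]

theorem IsTrajectory.isBigO_rate_of_lengthTo_eq_zero (hx : S.IsTrajectory x T)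
    (hL : lengthTo x T = 0) (hA : 0 < A) (hη : 0 ≤ η) (hμ : 0 < μ) (hD : D ≠ 0)
    (hν : S.IsLowerRegularAlong ν x T A μ D) (xinit : E N) (ε : ℝ) :
    (fun n => (Measure.pi (fun _ : Fin n => ν) (S.traceEvent xinit x T ε
      (4 * (A * scale ((1 + η) * (μ / D)) D n)) n)ᶜ).toReal) =O[atTop] rate η D := by
  obtain ⟨ρ₀, hρ₀, hmass⟩ := hν
  refine isBigO_toReal_of_eventually_le zero_le_one (rate_nonneg η D) ?_
  filter_upwards [eventually_gt_atTop 1, (tendsto_scale _ hD).eventually_le_const hρ₀] with n hn hρ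
  have hρ0 : 0 < scale ((1 + η) * (μ / D)) D n := scale_pos (by positivity) D hn
  refine (hx.measure_compl_traceEvent_le_of_lengthTo_eq_zero hL (by positivity)
    (b := scale ((1 + η) * (μ / D)) D n ^ D / μ) ?_ xinit ε n).trans ?_
  · rw [mul_div_cancel_left₀ _ four_ne_zero]
    exact hmass 0 (left_mem_Icc.2 hx.1) _ ⟨hρ0.le, hρ⟩
  · rw [mul_scale_pow_div hη hμ hD (by lia), one_mul]
    exact ENNReal.ofReal_le_ofReal (exp_neg_mul_log_le_rate hn η D)

theorem failure_bound_le_mul_rate (hA : 0 < A) (hη : 0 ≤ η) (hμ : 0 < μ) (hD : D ≠ 0) {n M : ℕ}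
    (hn : 1 < n) (P : ℕ) {L c β : ℝ}
    (hM : (M + 1) * (4 * (A * scale ((1 + η) * (μ / D)) D n)) ≤ 4 * L)
    (hlog : 2 ≤ c * β ^ D * ((1 + η) / D) * Real.log n) (hcM : 2 ≤ c * β ^ D * M) :
    (M + 1) * Real.exp (-(n * (scale ((1 + η) * (μ / D)) D n ^ D / μ))) +
      P * (2 ^ M * Real.exp (-(n * (c * M * ((β * scale ((1 + η) * (μ / D)) D n) ^ D / μ))))) ≤
    (L / A * (((1 + η) * (μ / D)) ^ (1 / (D : ℝ)))⁻¹ + P) * rate η D n := by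
  have hK : 0 < (1 + η) * (μ / D) := by positivity
  have hn0 : n ≠ 0 := by lia
  have hscale := mul_scale_pow_div hη hμ hD hn0
  have hρ := scale_pos hK D hn
  set ρ := scale ((1 + η) * (μ / D)) D n
  have hMρ : M + 1 ≤ L / A * ρ⁻¹ := by
    rw [← div_eq_mul_inv, div_div, le_div_iff₀ (by positivity)]
    linarith
  have hexponent : n * (c * M * ((β * ρ) ^ D / μ)) =
      c * β ^ D * ((1 + η) / D) * M * Real.log n := by
    rw [mul_pow]
    linear_combination c * M * β ^ D * hscale
  have hζ : 2 * ((1 + η) / D) ≤ c * β ^ D * ((1 + η) / D) * M := by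
    rw [mul_right_comm]
    gcongr
  rw [hscale, hexponent, add_mul (L / A * _), mul_assoc (L / A),
    ← inv_scale_mul_exp hK.le η D hn0, ← mul_assoc (L / A)]
  gcongr
  exact (two_pow_mul_exp_le (log_natCast_pos hn).le hlog hζ).trans
    (exp_neg_mul_log_le_rate hn η D)

theorem IsTrajectory.isBigO_rate_of_lengthTo_pos (hx : S.IsTrajectory x T)
    (hL : 0 < lengthTo x T) (hA : 0 < A) (hη : 0 ≤ η) (hμ : 0 < μ) (hD : D ≠ 0)
    (hν : S.IsLowerRegularAlong ν x T A μ D) (xinit : E N) (hε : 0 < ε) :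
    (fun n => (Measure.pi (fun _ : Fin n => ν) (S.traceEvent xinit x T ε
      (4 * (A * scale ((1 + η) * (μ / D)) D n)) n)ᶜ).toReal) =O[atTop] rate η D := by
  obtain ⟨ρ₀, hρ₀, hmass⟩ := hν
  obtain ⟨P, β, ⟨hβ0, hβ⟩, r₀, hr₀, hbound⟩ := hx.exists_measure_compl_traceEvent_le hL hε
  set c := ε / (4 * (P + 1))
  have : 0 < c := by positivity
  have hlog : Tendsto (fun n : ℕ => c * β ^ D * ((1 + η) / D) * Real.log n) atTop atTop :=
    (Real.tendsto_log_atTop.comp tendsto_natCast_atTop_atTop).const_mul_atTop (by positivity)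
  have hr : Tendsto (fun n => 4 * (A * scale ((1 + η) * (μ / D)) D n)) atTop (𝓝 0) := by
    simpa only [mul_zero] using ((tendsto_scale ((1 + η) * (μ / D)) hD).const_mul A).const_mul 4
  refine isBigO_toReal_of_eventually_le
    (C := lengthTo x T / A * (((1 + η) * (μ / D)) ^ (1 / (D : ℝ)))⁻¹ + P) (by positivity)
    (rate_nonneg η D) ?_
  filter_upwards [eventually_gt_atTop 1, hlog.eventually_ge_atTop 2,
    (tendsto_scale _ hD).eventually_le_const hρ₀, hr.eventually_le_const hr₀,
    hr.eventually_le_const (show 0 < c * β ^ D * lengthTo x T by positivity)]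
    with n hn hn2 hρ hrr₀ hrc
  have hρ0 : 0 < scale ((1 + η) * (μ / D)) D n := scale_pos (by positivity) D hn
  have hβρ : β * scale ((1 + η) * (μ / D)) D n ≤ scale ((1 + η) * (μ / D)) D n :=
    mul_le_of_le_one_left hρ0.le (by linarith)
  obtain ⟨M, hMlow, hMhigh, hprob⟩ := hbound _ ⟨by positivity, hrr₀⟩
  rw [mul_div_cancel_left₀ _ four_ne_zero, mul_left_comm β] at hprob
  refine (hprob ν _ _ (by positivity) (fun t ht => hmass t ht _ ⟨hρ0.le, hρ⟩)
    (fun t ht => hmass t ht _ ⟨by positivity, hβρ.trans hρ⟩) xinit n).trans ?_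
  rw [mul_div_right_comm]
  refine ENNReal.ofReal_le_ofReal (failure_bound_le_mul_rate hA hη hμ hD hn P hMhigh hn2 ?_)
  refine le_of_mul_le_mul_right ?_
    (show 0 < 4 * (A * scale ((1 + η) * (μ / D)) D n) by positivity)
  calc 2 * (4 * (A * scale ((1 + η) * (μ / D)) D n))
      ≤ 2 * (c * β ^ D * lengthTo x T) := by gcongr
    _ = c * β ^ D * (2 * lengthTo x T) := by ring
    _ ≤ c * β ^ D * (M * (4 * (A * scale ((1 + η) * (μ / D)) D n))) := by gcongr
    _ = c * β ^ D * M * (4 * (A * scale ((1 + η) * (μ / D)) D n)) := by ring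

theorem IsTrajectory.isBigO_rate (hx : S.IsTrajectory x T) (hA : 0 < A) (hη : 0 ≤ η) (hμ : 0 < μ)
    (hD : D ≠ 0) (hν : S.IsLowerRegularAlong ν x T A μ D) (xinit : E N) (hε : 0 < ε) :
    (fun n => (Measure.pi (fun _ : Fin n => ν) (S.traceEvent xinit x T ε
      (4 * (A * scale ((1 + η) * (μ / D)) D n)) n)ᶜ).toReal) =O[atTop] rate η D :=
  (lengthTo_nonneg x T).eq_or_lt.elim
    (fun hL => hx.isBigO_rate_of_lengthTo_eq_zero hL.symm hA hη hμ hD hν xinit ε)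
    (fun hL => hx.isBigO_rate_of_lengthTo_pos hL hA hη hμ hD hν xinit hε)

end LowerRegular

end System

end DCA

end

theorem mainTheorem1 {N m : ℕ} (S : DCA.System N m) (aMin AMax σMin θMin : ℝ)
    (hS : S.Assumptions aMin AMax σMin θMin)
    (Mobs : Set (DCA.E N)) (hobs : Mobs ⊆ S.M) (hopen : IsOpen (S.M \ Mobs))
    (hvol : volume (S.free Mobs) ≠ ⊤)
    (xinit : DCA.E N) (hxinit : xinit ∈ S.free Mobs)
    (x : ℝ → DCA.E N) (T : ℝ) (hx : S.IsTrajectory x T)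
    (δ : ℝ) (hδ : 0 < δ) (hclear : S.StrongClearance Mobs δ x T)
    (ε η : ℝ) (hε : 0 < ε) (hη : 0 ≤ η)
    (D : ℕ) (hD : D = S.homDim (x 0))
    (r : ℕ → ℝ) (hr : ∀ n, r n = DCA.System.radius AMax η (volume (S.free Mobs)).toReal D n) :
    (fun n : ℕ => (S.sampleFree Mobs n (S.traceEvent xinit x T ε (r n) n)ᶜ).toReal)
      =O[atTop] fun n : ℕ => (n : ℝ) ^ (-(η / D)) * (Real.log n) ^ (-(1 / (D : ℝ))) := by
  have hpos := DCA.System.volume_free_pos hopen ⟨xinit, hxinit⟩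
  have hprob := ProbabilityTheory.cond_isProbabilityMeasure_of_finite hpos.ne' hvol
  obtain rfl | hN := eq_or_ne N 0
  · have hD0 : D = 0 := by simp [hD, DCA.System.homDim]
    refine DCA.isBigO_toReal_of_eventually_le (C := 1) zero_le_one (DCA.rate_nonneg η D)
      (Eventually.of_forall fun n => ?_)
    simpa [hD0, DCA.rate, DCA.System.sampleFree] using prob_le_one (μ := Measure.pi fun _ : Fin n =>
      ProbabilityTheory.cond volume (S.free Mobs))
  have : NeZero N := ⟨hN⟩
  have hD0 : D ≠ 0 := hD ▸
    (DCA.System.homDim_pos hS.bracketGenerating (hx.2.2.1 0 (left_mem_Icc.2 hx.1))).ne'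
  have hregular := hS.isLowerRegularAlong hopen hvol hx hδ hclear
  rw [← hD] at hregular
  simp only [hr, DCA.System.radius_eq hη ENNReal.toReal_nonneg]
  exact hx.isBigO_rate hS.AMax_pos hη (ENNReal.toReal_pos hpos.ne' hvol) hD0 hregular xinit hε
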